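/- Consider $N\ge 1$ points $x_1,\dots,x_N\in\mathbb{R}^D$, $D\ge 1$, with weights $w_1,\dots,w_N\in\mathbb{Q}_{\ge 0}$, and a fuzzifier $m\in\mathbb{N}$, $m\ge 1$. A solution with $L$ clusters consists of means $C=(\mu_l)_{l\le L}$ in $\mathbb{R}^D$ and memberships $R=(r_{nl})_{n\le N,\,l\le L}$ in $[0,1]$ with $\sum_{l=1}^L r_{nl}=1$ for every $n$; its cost is \[ \phi_X^{(m)}(C,R)=\sum_{n=1}^N\sum_{l=1}^L r_{nl}^m\, w_n\,\|x_n-\mu_l\|^2 . \] For $R_{\min}\ge 0$ and $K\ge 1$ the memberships $R$ are called $(R_{\min},K)$-balanced if $L\le K$ and $\sum_{n=1}^N r_{nl}^m w_n\ge R_{\min}$ for every $l\le L$. An optimal $(R_{\min},K)$-balanced solution is one of smallest cost among all solutions (with any number of clusters) whose memberships are $(R_{\min},K)$-balanced. Theorem. There are absolute constants $c,p>0$ and a single randomized algorithm with the following properties. Let the input be $X=\{(x_n,w_n)\}_{n\le N}\subset\mathbb{R}^D\times\mathbb{Q}_{\ge 0}$, $K\in\mathbb{N}$, $m\in\mathbb{N}$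 (all of $N,D,K,m$ at least $1$), $\epsilon\in(0,1]$ and $\alpha\in(0,1]$, and let $R_{\min}=\alpha\sum_{n=1}^N w_n$. An optimal $(R_{\min},K)$-balanced solution exists, and the algorithm always halts with a solution $(C,R)$ with $K$ clusters such that, for every optimal $(R_{\min},K)$-balanced solution $(C^{opt},R^{opt})$, with probability at least $p$, \[ \phi_X^{(m)}(C,R)\le(1+\epsilon)\,\phi_X^{(m)}(C^{opt},R^{opt}) . \] For every outcome of the random choices its running time is at most \[ N\cdot D\cdot 2^{\,c\cdot\frac{K^2}{\epsilon}\cdot\max\{1,\ \log_2\frac{1}{\alpha\epsilon}\}} , \] that is, $N\cdot D\cdot 2^{O\left(\frac{K^2}{\epsilon}\log\frac{1}{\alpha\epsilon}\right)}$ whenever $\alpha\epsilon\le 1/2$. Running time is counted on a real RAM, whose memory consists of finitely many arrays of natural numbers and finitely many arrays of real numbers, with indirect addressing. Its unit-cost operations are memory access, $+,-,\times$ and comparison on natural numbers (subtraction is truncated at $0$), $+,-,\times,\div$ and comparison on real numbers, $k$-th powers and $k$-th roots of real numbers for a natural number $k$, conversion of a natural number to a real number, and drawing an independent uniformly distributed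 number from $[0,1]$. There is no rounding of reals to integers. -/

import Mathlib

open MeasureTheory

noncomputable section

/-! The fuzzy K-means problem. -/

namespace FuzzyKMeans

/-- Admissible memberships of `N` points in `L` clusters. -/
def IsMembership {N L : ℕ} (r : Fin N → Fin L → ℝ) : Prop :=
  (∀ n l, r n l ∈ Set.Icc (0 : ℝ) 1) ∧ ∀ n, ∑ l, r n l = 1

/-- The fuzzy `L`-means cost of the solution with means `μ` and memberships `r`. -/
def cost {N D L : ℕ} (m : ℕ) (x : Fin N → EuclideanSpace ℝ (Fin D)) (w : Fin N → ℝ)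
    (μ : Fin L → EuclideanSpace ℝ (Fin D)) (r : Fin N → Fin L → ℝ) : ℝ :=
  ∑ n, ∑ l, r n l ^ m * w n * ‖x n - μ l‖ ^ 2

/-- The weight of the `l`-th fuzzy cluster. -/
def clusterWeight {N L : ℕ} (m : ℕ) (w : Fin N → ℝ) (r : Fin N → Fin L → ℝ) (l : Fin L) : ℝ :=
  ∑ n, r n l ^ m * w n

/-- `(Rmin, K)`-balanced memberships. -/
def IsBalanced {N L : ℕ} (m : ℕ) (w : Fin N → ℝ) (Rmin : ℝ) (K : ℕ)
    (r : Fin N → Fin L → ℝ) : Prop :=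
  L ≤ K ∧ ∀ l, Rmin ≤ clusterWeight m w r l

/-- `(μ, r)` has the smallest cost among all solutions, with any number of clusters, whose
memberships are `(Rmin, K)`-balanced. -/
def IsOptimalBalanced {N D L : ℕ} (m : ℕ) (x : Fin N → EuclideanSpace ℝ (Fin D))
    (w : Fin N → ℝ) (Rmin : ℝ) (K : ℕ)
    (μ : Fin L → EuclideanSpace ℝ (Fin D)) (r : Fin N → Fin L → ℝ) : Prop :=
  IsMembership r ∧ IsBalanced m w Rmin K r ∧
    ∀ (L' : ℕ) (μ' : Fin L' → EuclideanSpace ℝ (Fin D)) (r' : Fin N → Fin L' → ℝ),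
      IsMembership r' → IsBalanced m w Rmin K r' → cost m x w μ r ≤ cost m x w μ' r'

end FuzzyKMeans

/-! A randomized real RAM, programmed by while programs.  The memory consists of arrays of natural
numbers (used for counting and addressing) and arrays of real numbers.  A program is a finite
object that can mention only finitely many arrays, and only natural numbers as constants.  There
is no rounding of reals to integers. -/

namespace RealRAM

/-- The memory: `ints a i` and `reals a i` are the `i`-th cells of the `a`-th integer array and of
the `a`-th real array; `pos` is the number of random numbers drawn so far. -/
structure State where
  ints : ℕ → ℕ → ℕ
  reals : ℕ → ℕ → ℝ
  pos : ℕ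

/-- Integer expressions; `load a i` reads cell `i` of integer array `a`. -/
inductive IExpr where
  | const (n : ℕ)
  | load (a : ℕ) (i : IExpr)
  | add (e f : IExpr)
  | sub (e f : IExpr)
  | mul (e f : IExpr)

/-- Real expressions; `load a i` reads cell `i` of real array `a`, `pow e k` is the `k`-th power of
`e`, and `root k e` is the `k`-th root of `e`. -/
inductive RExpr where
  | ofInt (e : IExpr)
  | load (a : ℕ) (i : IExpr)
  | add (e f : RExpr)
  | sub (e f : RExpr)
  | mul (e f : RExpr)
  | div (e f : RExpr)
  | pow (e : RExpr) (k : IExpr)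
  | root (k : IExpr) (e : RExpr)

/-- Tests. -/
inductive BExpr where
  | ile (e f : IExpr)
  | rle (e f : RExpr)
  | not (b : BExpr)
  | and (b c : BExpr)

/-- Programs. -/
inductive Cmd where
  | skip
  | iset (a : ℕ) (i : IExpr) (e : IExpr)
  | rset (a : ℕ) (i : IExpr) (e : RExpr)
  | draw (a : ℕ) (i : IExpr)
  | seq (p q : Cmd)
  | cond (b : BExpr) (p q : Cmd)
  | loop (b : BExpr) (p : Cmd)

/-- The value of an integer expression (subtraction is truncated at `0`). -/
def IExpr.eval (σ : State) : IExpr → ℕ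
  | .const n => n
  | .load a i => σ.ints a (i.eval σ)
  | .add e f => e.eval σ + f.eval σ
  | .sub e f => e.eval σ - f.eval σ
  | .mul e f => e.eval σ * f.eval σ

/-- The value of a real expression (division by `0` and roots of negative numbers yield `0`). -/
def RExpr.eval (σ : State) : RExpr → ℝ
  | .ofInt e => (e.eval σ : ℝ)
  | .load a i => σ.reals a (i.eval σ)
  | .add e f => e.eval σ + f.eval σ
  | .sub e f => e.eval σ - f.eval σ
  | .mul e f => e.eval σ * f.eval σ
  | .div e f => e.eval σ / f.eval σ
  | .pow e k => e.eval σ ^ k.eval σ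
  | .root k e => (max (e.eval σ) 0) ^ (1 / (k.eval σ : ℝ))

/-- The truth of a test. -/
def BExpr.Holds (σ : State) : BExpr → Prop
  | .ile e f => e.eval σ ≤ f.eval σ
  | .rle e f => e.eval σ ≤ f.eval σ
  | .not b => ¬ b.Holds σ
  | .and b c => b.Holds σ ∧ c.Holds σ

/-- The number of steps for evaluating an integer expression: one per operation, memory access and
constant. -/
def IExpr.steps : IExpr → ℕ
  | .const _ => 1
  | .load _ i => i.steps + 1
  | .add e f => e.steps + f.steps + 1
  | .sub e f => e.steps + f.steps + 1
  | .mul e f => e.steps + f.steps + 1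

/-- The number of steps for evaluating a real expression. -/
def RExpr.steps : RExpr → ℕ
  | .ofInt e => e.steps + 1
  | .load _ i => i.steps + 1
  | .add e f => e.steps + f.steps + 1
  | .sub e f => e.steps + f.steps + 1
  | .mul e f => e.steps + f.steps + 1
  | .div e f => e.steps + f.steps + 1
  | .pow e k => e.steps + k.steps + 1
  | .root k e => k.steps + e.steps + 1

/-- The number of steps for evaluating a test. -/
def BExpr.steps : BExpr → ℕ
  | .ile e f => e.steps + f.steps + 1
  | .rle e f => e.steps + f.steps + 1
  | .not b => b.steps + 1
  | .and b c => b.steps + c.steps + 1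

/-- Write the natural number `v` to cell `i` of integer array `a`. -/
def State.setInt (σ : State) (a i v : ℕ) : State :=
  { σ with ints := Function.update σ.ints a (Function.update (σ.ints a) i v) }

/-- Write the real number `v` to cell `i` of real array `a`. -/
def State.setReal (σ : State) (a i : ℕ) (v : ℝ) : State :=
  { σ with reals := Function.update σ.reals a (Function.update (σ.reals a) i v) }

/-- A random tape: the sequence of the numbers in `[0, 1]` that the successive draws return. -/
abbrev Tape : Type := ℕ → unitInterval

/-- The law of the random tape: independent uniformly distributed numbers in `[0, 1]`. -/
def tapeMeasure : Measure Tape :=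
  Measure.infinitePi fun _ : ℕ => (volume : Measure unitInterval)

/-- `Exec ω p σ τ t`: with random tape `ω` and started in state `σ`, the program `p` halts in state
`τ` after exactly `t` steps. -/
inductive Exec (ω : Tape) : Cmd → State → State → ℕ → Prop where
  | skip (σ : State) : Exec ω .skip σ σ 1
  | iset (σ : State) (a : ℕ) (i e : IExpr) :
      Exec ω (.iset a i e) σ (σ.setInt a (i.eval σ) (e.eval σ)) (i.steps + e.steps + 1)
  | rset (σ : State) (a : ℕ) (i : IExpr) (e : RExpr) :
      Exec ω (.rset a i e) σ (σ.setReal a (i.eval σ) (e.eval σ)) (i.steps + e.steps + 1)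
  | draw (σ : State) (a : ℕ) (i : IExpr) :
      Exec ω (.draw a i) σ
        { σ.setReal a (i.eval σ) (ω σ.pos : ℝ) with pos := σ.pos + 1 } (i.steps + 1)
  | seq {p q : Cmd} {σ ρ τ : State} {s t : ℕ} (hp : Exec ω p σ ρ s) (hq : Exec ω q ρ τ t) :
      Exec ω (.seq p q) σ τ (s + t)
  | condTrue {b : BExpr} {p q : Cmd} {σ τ : State} {t : ℕ} (hb : b.Holds σ)
      (hp : Exec ω p σ τ t) : Exec ω (.cond b p q) σ τ (b.steps + 1 + t)
  | condFalse {b : BExpr} {p q : Cmd} {σ τ : State} {t : ℕ} (hb : ¬ b.Holds σ)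
      (hq : Exec ω q σ τ t) : Exec ω (.cond b p q) σ τ (b.steps + 1 + t)
  | loopDone {b : BExpr} {p : Cmd} {σ : State} (hb : ¬ b.Holds σ) :
      Exec ω (.loop b p) σ σ (b.steps + 1)
  | loopStep {b : BExpr} {p : Cmd} {σ ρ τ : State} {s t : ℕ} (hb : b.Holds σ)
      (hp : Exec ω p σ ρ s) (hl : Exec ω (.loop b p) ρ τ t) :
      Exec ω (.loop b p) σ τ (b.steps + 1 + s + t)

/-- The final state and the number of steps are determined by the tape and the initial state. -/
theorem Exec.deterministic {ω : Tape} {p : Cmd} {σ τ : State} {t : ℕ} (h : Exec ω p σ τ t) :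
    ∀ {τ' : State} {t' : ℕ}, Exec ω p σ τ' t' → τ = τ' ∧ t = t' := by
  induction h with
  | skip => intro _ _ h; cases h; exact ⟨rfl, rfl⟩
  | iset => intro _ _ h; cases h; exact ⟨rfl, rfl⟩
  | rset => intro _ _ h; cases h; exact ⟨rfl, rfl⟩
  | draw => intro _ _ h; cases h; exact ⟨rfl, rfl⟩
  | seq _ _ ihp ihq =>
    intro _ _ h
    cases h with
    | seq hp hq =>
      obtain ⟨rfl, rfl⟩ := ihp hp
      obtain ⟨rfl, rfl⟩ := ihq hq
      exact ⟨rfl, rfl⟩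
  | condTrue hb _ ih =>
    intro _ _ h
    cases h with
    | condTrue _ hp => obtain ⟨rfl, rfl⟩ := ih hp; exact ⟨rfl, rfl⟩
    | condFalse hn _ => exact absurd hb hn
  | condFalse hb _ ih =>
    intro _ _ h
    cases h with
    | condTrue hn _ => exact absurd hn hb
    | condFalse _ hq => obtain ⟨rfl, rfl⟩ := ih hq; exact ⟨rfl, rfl⟩
  | loopDone hb =>
    intro _ _ h
    cases h with
    | loopDone _ => exact ⟨rfl, rfl⟩
    | loopStep hn _ _ => exact absurd hn hb
  | loopStep hb _ _ ihp ihl =>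
    intro _ _ h
    cases h with
    | loopDone hn => exact absurd hb hn
    | loopStep _ hp hl =>
      obtain ⟨rfl, rfl⟩ := ihp hp
      obtain ⟨rfl, rfl⟩ := ihl hl
      exact ⟨rfl, rfl⟩

/-- The initial state for the input `(x, w)`, `K`, `m`, `ε`, `α`.
Integer array `0` holds `N, D, K, m`; real array `0` holds `ε, α`; real array `1` holds the `N`
weights; real array `2` holds coordinate `d` of point `n` in cell `n * D + d`.
All other cells hold `0`. -/
def initState {N D : ℕ} (x : Fin N → EuclideanSpace ℝ (Fin D)) (w : Fin N → ℝ) (K m : ℕ)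
    (ε α : ℝ) : State where
  ints := fun a i => if a = 0 then
      (if i = 0 then N else if i = 1 then D else if i = 2 then K else if i = 3 then m else 0)
    else 0
  reals := fun a i =>
    if a = 0 then (if i = 0 then ε else if i = 1 then α else 0)
    else if a = 1 then (if h : i < N then w ⟨i, h⟩ else 0)
    else if a = 2 then
      (if h : i < N * D then
        x ⟨i / D, Nat.div_lt_of_lt_mul (by rwa [Nat.mul_comm] at h)⟩
          ⟨i % D, Nat.mod_lt _ (Nat.pos_of_ne_zero (by rintro rfl; simp at h))⟩
      else 0)
    else 0
  pos := 0

/-- The means in the output: coordinate `d` of mean `k` is in cell `k * D + d` of real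
array `3`. -/
def outMeans (D K : ℕ) (σ : State) (k : Fin K) : EuclideanSpace ℝ (Fin D) :=
  WithLp.toLp 2 fun d : Fin D => σ.reals 3 (k * D + d)

/-- The memberships in the output: the membership of point `n` in cluster `k` is in cell
`n * K + k` of real array `4`. -/
def outMemberships (N K : ℕ) (σ : State) (n : Fin N) (k : Fin K) : ℝ :=
  σ.reals 4 (n * K + k)

end RealRAM

end

/-! The algorithm makes `T = ⌈2 / α ^ (K * s)⌉₊` trials with `s = ⌈2 / ε⌉₊`. A trial draws `K`
blocks of `s` points, independently and with probabilities proportional to the weights, and takes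
the `K` block averages as means. The cheapest trial wins, each being judged by its cost with optimal
memberships.

Fix a balanced solution `(μ, r)` and let `W` be the total weight. Its fuzzy cluster `l` is a
subdistribution `a n = r n l ^ m * w n ≤ w n` of mass `A ≥ α * W`, so that `w n / W ≥ α * (a n /
A)`. Hence the law of all `K * s` draws dominates `α ^ (K * s)` times the law in which block `l` is
drawn from cluster `l` itself. Under that ideal law an average of `s` points misses the centroid of
its cluster by `1 / s` of the variance in expected square. Weighted by the masses and summed over
clusters, the expected miss is at most `ε / 2` times the cost `C` at the centroids. By Markov's
inequality it is at most `ε * C` with probability at least `1 / 2`, and by the parallel axis theorem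
the sampled means then cost at most `(1 + ε) * C`. So a trial succeeds with probability at least `α
^ (K * s) / 2` (`le_sum_prod_good`, `le_sum_prod_isGoodSample`), and all `T` independent trials fail
with probability at most `exp (-1) < 1 / 2` (`half_le_tapeMeasure_exists_block`).

For fixed means the cost splits over the points, and the memberships proportional to `d ^ (-1 / (m -
1))` satisfy the Karush-Kuhn-Tucker conditions (`sum_optMembership_pow_le`); ties with zero distance
and `m = 1` put everything on one nearest mean. An optimal balanced solution exists by compactness,
since balanced clusters have mass bounded away from zero (`exists_isOptimalBalanced`).

The program is verified in a Hoare-style calculus with step budgets (`Runs`). Its step count is `O(N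
* D * K * s * T)`, which `steps_factor_le` turns into the stated bound. -/

noncomputable section

namespace RealRAM

/-! Total correctness with time bounds. -/

/-- Whether a program contains a write to integer array `a`. -/
def Cmd.writesInt (a : ℕ) : Cmd → Bool
  | .skip => false
  | .iset b _ _ => a == b
  | .rset _ _ _ => false
  | .draw _ _ => false
  | .seq p q => p.writesInt a || q.writesInt a
  | .cond _ p q => p.writesInt a || q.writesInt a
  | .loop _ p => p.writesInt a

/-- Whether a program contains a write to real array `a`. -/
def Cmd.writesReal (a : ℕ) : Cmd → Bool
  | .skip => false
  | .iset _ _ _ => false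
  | .rset b _ _ => a == b
  | .draw b _ => a == b
  | .seq p q => p.writesReal a || q.writesReal a
  | .cond _ p q => p.writesReal a || q.writesReal a
  | .loop _ p => p.writesReal a

/-- Whether a program contains a draw. -/
def Cmd.draws : Cmd → Bool
  | .skip => false
  | .iset _ _ _ => false
  | .rset _ _ _ => false
  | .draw _ _ => true
  | .seq p q => p.draws || q.draws
  | .cond _ p q => p.draws || q.draws
  | .loop _ p => p.draws

/-- `σ` and `τ` agree on everything that `p` does not mention as a target. -/
structure Same (p : Cmd) (σ τ : State) : Prop where
  ints : ∀ a, p.writesInt a = false → τ.ints a = σ.ints a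
  reals : ∀ a, p.writesReal a = false → τ.reals a = σ.reals a
  pos : p.draws = false → τ.pos = σ.pos

theorem Same.rfl' {p : Cmd} {σ : State} : Same p σ σ :=
  ⟨fun _ _ => rfl, fun _ _ => rfl, fun _ => rfl⟩

theorem Same.trans {p : Cmd} {σ ρ τ : State} (h : Same p σ ρ) (h' : Same p ρ τ) : Same p σ τ :=
  ⟨fun a ha => (h'.ints a ha).trans (h.ints a ha),
    fun a ha => (h'.reals a ha).trans (h.reals a ha), fun ha => (h'.pos ha).trans (h.pos ha)⟩

theorem Same.mono {p q : Cmd} {σ τ : State} (h : Same p σ τ)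
    (hi : ∀ a, q.writesInt a = false → p.writesInt a = false)
    (hr : ∀ a, q.writesReal a = false → p.writesReal a = false)
    (hd : q.draws = false → p.draws = false) : Same q σ τ :=
  ⟨fun a ha => h.ints a (hi a ha), fun a ha => h.reals a (hr a ha), fun ha => h.pos (hd ha)⟩

@[simp] theorem setInt_ints (σ : State) (a i v b j : ℕ) :
    (σ.setInt a i v).ints b j = if b = a ∧ j = i then v else σ.ints b j := by
  by_cases hb : b = a
  · subst hb
    by_cases hj : j = i <;> simp [State.setInt, hj]
  · simp [State.setInt, hb]

@[simp] theorem setInt_reals (σ : State) (a i v : ℕ) : (σ.setInt a i v).reals = σ.reals := rfl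

@[simp] theorem setInt_pos (σ : State) (a i v : ℕ) : (σ.setInt a i v).pos = σ.pos := rfl

@[simp] theorem setReal_reals (σ : State) (a i : ℕ) (v : ℝ) (b j : ℕ) :
    (σ.setReal a i v).reals b j = if b = a ∧ j = i then v else σ.reals b j := by
  by_cases hb : b = a
  · subst hb
    by_cases hj : j = i <;> simp [State.setReal, hj]
  · simp [State.setReal, hb]

@[simp] theorem setReal_ints (σ : State) (a i : ℕ) (v : ℝ) : (σ.setReal a i v).ints = σ.ints := rfl

@[simp] theorem setReal_pos (σ : State) (a i : ℕ) (v : ℝ) : (σ.setReal a i v).pos = σ.pos := rfl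

theorem setInt_ints_ne (σ : State) {a b : ℕ} (i v : ℕ) (h : b ≠ a) :
    (σ.setInt a i v).ints b = σ.ints b := by
  funext j; simp [h]

theorem setReal_reals_ne (σ : State) {a b : ℕ} (i : ℕ) (v : ℝ) (h : b ≠ a) :
    (σ.setReal a i v).reals b = σ.reals b := by
  funext j; simp [h]

/-- Programs change only the arrays that they mention as targets. -/
theorem Exec.same {ω : Tape} {p : Cmd} {σ τ : State} {t : ℕ} (h : Exec ω p σ τ t) :
    Same p σ τ := by
  induction h with
  | skip => exact Same.rfl'
  | iset σ a i e =>
    refine ⟨fun b hb => setInt_ints_ne _ _ _ ?_, fun _ _ => rfl, fun _ => rfl⟩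
    simpa [Cmd.writesInt] using hb
  | rset σ a i e =>
    refine ⟨fun _ _ => rfl, fun b hb => setReal_reals_ne _ _ _ ?_, fun _ => rfl⟩
    simpa [Cmd.writesReal] using hb
  | draw σ a i =>
    refine ⟨fun _ _ => rfl, fun b hb => setReal_reals_ne σ _ _ ?_, fun h => by
      simp [Cmd.draws] at h⟩
    simpa [Cmd.writesReal] using hb
  | seq _ _ ihp ihq =>
    refine (ihp.mono ?_ ?_ ?_).trans (ihq.mono ?_ ?_ ?_) <;>
      simp +contextual [Cmd.writesInt, Cmd.writesReal, Cmd.draws]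
  | condTrue _ _ ih =>
    refine ih.mono ?_ ?_ ?_ <;> simp +contextual [Cmd.writesInt, Cmd.writesReal, Cmd.draws]
  | condFalse _ _ ih =>
    refine ih.mono ?_ ?_ ?_ <;> simp +contextual [Cmd.writesInt, Cmd.writesReal, Cmd.draws]
  | loopDone => exact Same.rfl'
  | loopStep _ _ _ ihp ihl =>
    refine (ihp.mono ?_ ?_ ?_).trans ihl <;>
      simp +contextual [Cmd.writesInt, Cmd.writesReal, Cmd.draws]

/-- Started in `σ`, the program halts after at most `B` steps in a state that satisfies `Q`. -/
def Runs (ω : Tape) (p : Cmd) (σ : State) (B : ℕ) (Q : State → Prop) : Prop :=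
  ∃ τ t, Exec ω p σ τ t ∧ t ≤ B ∧ Q τ

section

variable {ω : Tape} {p q : Cmd} {σ : State} {B B' : ℕ} {Q Q' : State → Prop}

/-- The consequence rule includes the frame: the new postcondition may use that arrays which `p`
does not write are unchanged. -/
theorem Runs.mono (h : Runs ω p σ B Q) (hB : B ≤ B') (hQ : ∀ τ, Same p σ τ → Q τ → Q' τ) :
    Runs ω p σ B' Q' := by
  obtain ⟨τ, t, he, ht, hq⟩ := h
  exact ⟨τ, t, he, ht.trans hB, hQ τ he.same hq⟩

theorem Runs.weaken (h : Runs ω p σ B Q) (hB : B ≤ B') : Runs ω p σ B' Q :=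
  h.mono hB fun _ _ h => h

theorem Runs.skip (h : Q σ) : Runs ω .skip σ 1 Q := ⟨_, _, .skip σ, le_rfl, h⟩

theorem Runs.iset {a : ℕ} {i e : IExpr} (h : Q (σ.setInt a (i.eval σ) (e.eval σ))) :
    Runs ω (.iset a i e) σ (i.steps + e.steps + 1) Q := ⟨_, _, .iset σ a i e, le_rfl, h⟩

theorem Runs.rset {a : ℕ} {i : IExpr} {e : RExpr} (h : Q (σ.setReal a (i.eval σ) (e.eval σ))) :
    Runs ω (.rset a i e) σ (i.steps + e.steps + 1) Q := ⟨_, _, .rset σ a i e, le_rfl, h⟩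

theorem Runs.draw {a : ℕ} {i : IExpr}
    (h : Q { σ.setReal a (i.eval σ) (ω σ.pos : ℝ) with pos := σ.pos + 1 }) :
    Runs ω (.draw a i) σ (i.steps + 1) Q := ⟨_, _, .draw σ a i, le_rfl, h⟩

theorem Runs.seq {R : State → Prop} (h : Runs ω p σ B R)
    (h' : ∀ ρ, Same p σ ρ → R ρ → Runs ω q ρ B' Q) : Runs ω (.seq p q) σ (B + B') Q := by
  obtain ⟨ρ, s, he, hs, hr⟩ := h
  obtain ⟨τ, t, he', ht, hq⟩ := h' ρ he.same hr
  exact ⟨τ, s + t, .seq he he', by omega, hq⟩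

theorem Runs.seq_iset {a : ℕ} {i e : IExpr}
    (h : Runs ω q (σ.setInt a (i.eval σ) (e.eval σ)) B Q) :
    Runs ω (.seq (.iset a i e) q) σ (i.steps + e.steps + 1 + B) Q :=
  Runs.seq (R := fun ρ => ρ = σ.setInt a (i.eval σ) (e.eval σ)) (.iset rfl)
    fun _ _ h' => h' ▸ h

theorem Runs.seq_rset {a : ℕ} {i : IExpr} {e : RExpr}
    (h : Runs ω q (σ.setReal a (i.eval σ) (e.eval σ)) B Q) :
    Runs ω (.seq (.rset a i e) q) σ (i.steps + e.steps + 1 + B) Q :=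
  Runs.seq (R := fun ρ => ρ = σ.setReal a (i.eval σ) (e.eval σ)) (.rset rfl)
    fun _ _ h' => h' ▸ h

theorem Runs.seq_draw {a : ℕ} {i : IExpr}
    (h : Runs ω q { σ.setReal a (i.eval σ) (ω σ.pos : ℝ) with pos := σ.pos + 1 } B Q) :
    Runs ω (.seq (.draw a i) q) σ (i.steps + 1 + B) Q :=
  Runs.seq (R := fun ρ => ρ = { σ.setReal a (i.eval σ) (ω σ.pos : ℝ) with pos := σ.pos + 1 })
    (.draw rfl) fun _ _ h' => h' ▸ h

/-- Both budgets are added, which is wasteful but keeps maxima out of the bounds. -/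
theorem Runs.cond {b : BExpr} (ht : b.Holds σ → Runs ω p σ B Q)
    (hf : ¬ b.Holds σ → Runs ω q σ B' Q) :
    Runs ω (.cond b p q) σ (b.steps + 1 + (B + B')) Q := by
  by_cases hb : b.Holds σ
  · obtain ⟨τ, t, he, ht, hq⟩ := ht hb
    exact ⟨τ, _, .condTrue hb he, by omega, hq⟩
  · obtain ⟨τ, t, he, ht, hq⟩ := hf hb
    exact ⟨τ, _, .condFalse hb he, by omega, hq⟩

/-- The rule for loops with a known number of rounds. -/
theorem Runs.loop {b : BExpr} (n : ℕ) (Inv : ℕ → State → Prop) (h0 : Inv 0 σ)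
    (hstep : ∀ i < n, ∀ ρ, Same p σ ρ → Inv i ρ → b.Holds ρ ∧ Runs ω p ρ B (Inv (i + 1)))
    (hend : ∀ ρ, Same p σ ρ → Inv n ρ → ¬ b.Holds ρ) :
    Runs ω (.loop b p) σ (n * (b.steps + 1 + B) + (b.steps + 1)) (Inv n) := by
  -- Induction on the number `j` of rounds that remain.
  suffices H : ∀ j ≤ n, ∀ ρ, Same p σ ρ → Inv (n - j) ρ →
      Runs ω (.loop b p) ρ (j * (b.steps + 1 + B) + (b.steps + 1)) (Inv n) by
    exact H n le_rfl σ Same.rfl' (by simpa using h0)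
  intro j
  induction j with
  | zero =>
    intro _ ρ hS hI
    exact ⟨ρ, _, .loopDone (hend ρ hS hI), by omega, hI⟩
  | succ j ih =>
    intro hj ρ hS hI
    obtain ⟨hb, ρ', s, he, hs, hI'⟩ := hstep (n - (j + 1)) (by omega) ρ hS hI
    rw [show n - (j + 1) + 1 = n - j by omega] at hI'
    obtain ⟨τ, t, he', ht, hQ⟩ := ih (by omega) ρ' (hS.trans he.same) hI'
    exact ⟨τ, _, .loopStep hb he he', by rw [add_mul, one_mul]; omega, hQ⟩

end

/-- `for` the integer cell `(c, 0)` from `0` below `e`. -/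
def forTo (c : ℕ) (e : IExpr) (p : Cmd) : Cmd :=
  .seq (.iset c (.const 0) (.const 0))
    (.loop (.ile (.add (.load c (.const 0)) (.const 1)) e)
      (.seq p (.iset c (.const 0) (.add (.load c (.const 0)) (.const 1)))))

/-- The data that the subroutines read: input sizes, numbers of samples and trials, weights,
coordinates, and the total weight. -/
structure Params where
  (N D K m s T : ℕ)
  (w x : ℕ → ℝ)
  (W : ℝ)

/-- The data are where the subroutines expect them. -/
structure Env (P : Params) (σ : State) : Prop where
  hN : σ.ints 0 0 = P.N
  hD : σ.ints 0 1 = P.D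
  hK : σ.ints 0 2 = P.K
  hm : σ.ints 0 3 = P.m
  hs : σ.ints 1 0 = P.s
  hT : σ.ints 1 1 = P.T
  hw : σ.reals 1 = P.w
  hx : σ.reals 2 = P.x
  hW : σ.reals 6 0 = P.W

/-- Whether the program leaves the data alone. -/
def Cmd.keepsEnv (p : Cmd) : Bool :=
  !p.writesInt 0 && !p.writesInt 1 && !p.writesReal 1 && !p.writesReal 2 && !p.writesReal 6

/-- The condition on `p` is a Boolean computation, so for a concrete program it is proved by `rfl`.
-/
theorem Env.of_same {P : Params} {p : Cmd} {σ τ : State} (h : Env P σ) (hS : Same p σ τ)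
    (hp : p.keepsEnv = true) : Env P τ := by
  simp only [Cmd.keepsEnv, Bool.and_eq_true, Bool.not_eq_true'] at hp
  obtain ⟨⟨⟨⟨h0, h1⟩, h2⟩, h3⟩, h4⟩ := hp
  obtain ⟨a1, a2, a3, a4, a5, a6, a7, a8, a9⟩ := h
  constructor <;>
    simp only [hS.ints _ h0, hS.ints _ h1, hS.reals _ h2, hS.reals _ h3, hS.reals _ h4] <;>
    assumption

theorem Env.setInt {P : Params} {σ : State} (h : Env P σ) (a i v : ℕ) (h0 : a ≠ 0)
    (h1 : a ≠ 1) : Env P (σ.setInt a i v) := by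
  obtain ⟨a1, a2, a3, a4, a5, a6, a7, a8, a9⟩ := h
  constructor <;> simp [h0.symm, h1.symm, *]

theorem Env.setReal {P : Params} {σ : State} (h : Env P σ) (a i : ℕ) (v : ℝ) (h1 : a ≠ 1)
    (h2 : a ≠ 2) (h6 : a ≠ 6) : Env P (σ.setReal a i v) := by
  obtain ⟨a1, a2, a3, a4, a5, a6, a7, a8, a9⟩ := h
  constructor
  case hw => rw [setReal_reals_ne _ _ _ h1.symm, a7]
  case hx => rw [setReal_reals_ne _ _ _ h2.symm, a8]
  all_goals simp [h6.symm, *]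

/-- The rule for `for` loops. -/
theorem Runs.forTo {ω : Tape} {P : Params} {σ : State} {c : ℕ} {e : IExpr} {p : Cmd} {B : ℕ}
    (n : ℕ) (Inv : ℕ → State → Prop) (hσ : Env P σ) (he : ∀ ρ, Env P ρ → e.eval ρ = n)
    (hp : (RealRAM.forTo c e p).keepsEnv = true) (hc : p.writesInt c = false)
    (h0 : Inv 0 (σ.setInt c 0 0))
    (hstep : ∀ i < n, ∀ ρ, Env P ρ → Same (RealRAM.forTo c e p) σ ρ → ρ.ints c 0 = i → Inv i ρ →
      Runs ω p ρ B fun τ => Inv (i + 1) (τ.setInt c 0 (i + 1))) :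
    Runs ω (RealRAM.forTo c e p) σ (n * (e.steps + 12 + B) + (e.steps + 9))
      fun τ => Env P τ ∧ Inv n τ := by
  have hS0 : Same (RealRAM.forTo c e p) σ (σ.setInt c 0 0) :=
    ((Exec.iset (ω := ω) σ c (.const 0) (.const 0)).same).mono
      (by simp +contextual [RealRAM.forTo, Cmd.writesInt])
      (by simp +contextual [Cmd.writesReal]) (by simp +contextual [Cmd.draws])
  refine Runs.mono (Runs.seq_iset (B := n * (e.steps + 12 + B) + (e.steps + 6))
    (Q := fun τ => τ.ints c 0 = n ∧ Inv n τ) ?_)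
    (by simp only [IExpr.steps]; omega) fun τ hS hI => ⟨hσ.of_same hS hp, hI.2⟩
  simp only [IExpr.eval]
  have key : ∀ ρ, Same (.seq p (.iset c (.const 0) (.add (.load c (.const 0)) (.const 1))))
      (σ.setInt c 0 0) ρ → Same (RealRAM.forTo c e p) σ ρ := fun ρ hS =>
    hS0.trans (hS.mono (by simp +contextual [RealRAM.forTo, Cmd.writesInt])
      (by simp +contextual [RealRAM.forTo, Cmd.writesReal])
      (by simp +contextual [RealRAM.forTo, Cmd.draws]))
  refine Runs.weaken (Runs.loop (B := B + 6) n (fun i ρ => ρ.ints c 0 = i ∧ Inv i ρ) ?_ ?_ ?_) ?_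
  · exact ⟨by simp, h0⟩
  · rintro i hi ρ hS ⟨hci, hI⟩
    have hS' := key ρ hS
    have hE := hσ.of_same hS' hp
    refine ⟨by simp only [BExpr.Holds, IExpr.eval, he ρ hE, hci]; omega, ?_⟩
    refine Runs.seq (hstep i hi ρ hE hS' hci hI) fun τ hSp hI' => ?_
    refine Runs.weaken (Runs.iset ?_) (by simp [IExpr.steps])
    have hci' : τ.ints c 0 = i := by rw [hSp.ints c hc, hci]
    simp only [IExpr.eval, hci']
    exact ⟨by simp, hI'⟩
  · rintro ρ hS ⟨hci, -⟩
    have hE := hσ.of_same (key ρ hS) hp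
    simp only [BExpr.Holds, IExpr.eval, he ρ hE, hci]; omega
  · simp only [BExpr.steps, IExpr.steps]
    rw [show 1 + 1 + 1 + 1 + e.steps + 1 + 1 + (B + 6) = e.steps + 12 + B by ring]
    omega

end RealRAM

namespace FuzzyKMeans

/-! Optimal memberships for given means. -/

/-- The first index below `k` at which `d` is smallest. -/
def argMin (d : ℕ → ℝ) : ℕ → ℕ
  | 0 => 0
  | k + 1 => if d k < d (argMin d k) then k else argMin d k

theorem argMin_lt (d : ℕ → ℝ) {K : ℕ} (hK : 1 ≤ K) : argMin d K < K := by
  induction K, hK using Nat.le_induction with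
  | base => simp [argMin]
  | succ k _ ih => rw [argMin]; split_ifs <;> omega

theorem argMin_le (d : ℕ → ℝ) {K k : ℕ} (hk : k < K) : d (argMin d K) ≤ d k := by
  induction K with
  | zero => omega
  | succ K ih =>
    rw [argMin]
    split_ifs with h
    · rcases Nat.lt_succ_iff_lt_or_eq.1 hk with h' | rfl
      · exact h.le.trans (ih h')
      · exact le_rfl
    · rcases Nat.lt_succ_iff_lt_or_eq.1 hk with h' | rfl
      · exact ih h'
      · exact not_lt.1 h

/-- Unnormalized optimal memberships of a point with squared distances `d`, the smallest of which
is `d b`. -/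
def rawMembership (m : ℕ) (d : ℕ → ℝ) (b k : ℕ) : ℝ :=
  -- In the first case all mass goes to one nearest mean. In the second, the factor `d b` is
  -- cancelled by normalization; it makes the entry at `b` equal to `1`.
  if m ≤ 1 ∨ d b ≤ 0 then if k = b then 1 else 0
  else (max (d b / d k) 0) ^ (1 / ((m - 1 : ℕ) : ℝ))

/-- Optimal memberships of a point with squared distances `d`. -/
def optMembership (m K : ℕ) (d : ℕ → ℝ) (k : ℕ) : ℝ :=
  rawMembership m d (argMin d K) k / ∑ j ∈ Finset.range K, rawMembership m d (argMin d K) j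

theorem rawMembership_nonneg (m : ℕ) (d : ℕ → ℝ) (b k : ℕ) : 0 ≤ rawMembership m d b k := by
  unfold rawMembership
  split_ifs <;> positivity

theorem rawMembership_self_pos (m : ℕ) (d : ℕ → ℝ) (b : ℕ) : 0 < rawMembership m d b b := by
  unfold rawMembership
  rw [if_pos rfl]
  split_ifs with h
  · exact one_pos
  · rw [div_self (not_le.1 (not_or.1 h).2).ne']
    norm_num

theorem sum_rawMembership_pos (m : ℕ) (d : ℕ → ℝ) {K : ℕ} (hK : 1 ≤ K) :
    0 < ∑ j ∈ Finset.range K, rawMembership m d (argMin d K) j :=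
  Finset.sum_pos' (fun _ _ => rawMembership_nonneg _ _ _ _)
    ⟨argMin d K, Finset.mem_range.2 (argMin_lt d hK), rawMembership_self_pos _ _ _⟩

theorem optMembership_nonneg (m K : ℕ) (d : ℕ → ℝ) (k : ℕ) : 0 ≤ optMembership m K d k :=
  div_nonneg (rawMembership_nonneg _ _ _ _)
    (Finset.sum_nonneg fun _ _ => rawMembership_nonneg _ _ _ _)

theorem sum_optMembership (m : ℕ) (d : ℕ → ℝ) {K : ℕ} (hK : 1 ≤ K) :
    ∑ k ∈ Finset.range K, optMembership m K d k = 1 := by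
  unfold optMembership
  rw [← Finset.sum_div, div_self (sum_rawMembership_pos m d hK).ne']

theorem optMembership_le_one (m : ℕ) (d : ℕ → ℝ) {K k : ℕ} (hk : k < K) :
    optMembership m K d k ≤ 1 := by
  rw [← sum_optMembership m d (K := K) (by omega)]
  exact Finset.single_le_sum (f := optMembership m K d)
    (fun j _ => optMembership_nonneg m K d j) (Finset.mem_range.2 hk)

/-- The graph of a power lies above its tangents. -/
theorem tangent_le_pow {q r : ℝ} (hq : 0 ≤ q) (hr : 0 ≤ r) (n : ℕ) :
    q ^ (n + 1) + (n + 1) * q ^ n * (r - q) ≤ r ^ (n + 1) := by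
  induction n with
  | zero => simp
  | succ n ih =>
    have h1 := mul_le_mul_of_nonneg_right ih hr
    -- This is exactly the excess of `r` times the tangent for `n` over the tangent for `n + 1`.
    have h2 : 0 ≤ (n + 1) * q ^ n * (r - q) ^ 2 := by positivity
    push_cast
    rw [pow_succ r (n + 1)]
    refine le_trans (le_of_eq_of_le ?_ (sub_le_self _ h2)) h1
    ring

/-- Optimality from the Karush-Kuhn-Tucker conditions. -/
theorem sum_pow_mul_le_of_kkt {K n : ℕ} {d q r : ℕ → ℝ} {c : ℝ}
    (hd : ∀ k < K, 0 ≤ d k) (hq : ∀ k < K, 0 ≤ q k) (hr : ∀ k < K, 0 ≤ r k)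
    (hs : ∑ k ∈ Finset.range K, q k = ∑ k ∈ Finset.range K, r k)
    (hle : ∀ k < K, c ≤ d k * q k ^ n) (heq : ∀ k < K, q k ≠ 0 → d k * q k ^ n = c) :
    ∑ k ∈ Finset.range K, q k ^ (n + 1) * d k ≤ ∑ k ∈ Finset.range K, r k ^ (n + 1) * d k := by
  -- The tangent bound, with the slope replaced by the common multiplier `(n + 1) * c`. The linear
  -- terms cancel in the sum over `k` because `q` and `r` have the same total.
  have h : ∀ k ∈ Finset.range K, q k ^ (n + 1) * d k + (n + 1) * c * (r k - q k) ≤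
      r k ^ (n + 1) * d k := by
    intro k hk
    have hk := Finset.mem_range.1 hk
    have h1 := mul_le_mul_of_nonneg_right (tangent_le_pow (hq k hk) (hr k hk) n) (hd k hk)
    have h2 : c * (r k - q k) ≤ d k * q k ^ n * (r k - q k) := by
      by_cases h0 : q k = 0
      · exact mul_le_mul_of_nonneg_right (hle k hk) (by rw [h0, sub_zero]; exact hr k hk)
      · rw [heq k hk h0]
    have h3 := mul_le_mul_of_nonneg_left h2 (show (0 : ℝ) ≤ n + 1 by positivity)
    nlinarith
  have := Finset.sum_le_sum h
  rw [Finset.sum_add_distrib, ← Finset.mul_sum, Finset.sum_sub_distrib, hs, sub_self, mul_zero,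
    add_zero] at this
  exact this

/-- The multiplier is the smallest distance if `m = 1`, and `0` if `m > 1` and that distance
vanishes. Otherwise the `(m - 1)`-th power of the membership is inversely proportional to `d k`, so
the product with `d k` is the same for all `k`. -/
theorem sum_optMembership_pow_le {m K : ℕ} (hm : 1 ≤ m) (hK : 1 ≤ K) {d r : ℕ → ℝ}
    (hd : ∀ k < K, 0 ≤ d k) (hr : ∀ k < K, 0 ≤ r k) (hs : ∑ k ∈ Finset.range K, r k = 1) :
    ∑ k ∈ Finset.range K, optMembership m K d k ^ m * d k ≤
      ∑ k ∈ Finset.range K, r k ^ m * d k := by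
  obtain ⟨n, rfl⟩ : ∃ n, m = n + 1 := ⟨m - 1, by omega⟩
  have hb := argMin_lt d hK
  have hS := sum_rawMembership_pos (n + 1) d hK
  have hsum := sum_optMembership (n + 1) d hK
  have hnn := optMembership_nonneg (n + 1) K d
  by_cases h : n + 1 ≤ 1 ∨ d (argMin d K) ≤ 0
  · have hne : ∀ k, optMembership (n + 1) K d k ≠ 0 → k = argMin d K := by
      intro k hk
      by_contra hkb
      exact hk (by rw [optMembership, rawMembership, if_pos h, if_neg hkb, zero_div])
    by_cases hn : n = 0
    · subst hn
      refine sum_pow_mul_le_of_kkt (c := d (argMin d K)) hd (fun k _ => hnn k) hr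
        (hsum.trans hs.symm) (fun k hk => ?_) fun k _ h0 => ?_
      · simpa using argMin_le d hk
      · rw [hne k h0]; simp
    · have h0 : d (argMin d K) = 0 := le_antisymm (h.resolve_left (by omega)) (hd _ hb)
      refine sum_pow_mul_le_of_kkt (c := 0) hd (fun k _ => hnn k) hr
        (hsum.trans hs.symm) (fun k hk => mul_nonneg (hd k hk) (pow_nonneg (hnn k) _))
        fun k _ hk => ?_
      rw [hne k hk, h0, zero_mul]
  · have key : ∀ k < K, d k * optMembership (n + 1) K d k ^ n =
        d (argMin d K) / (∑ j ∈ Finset.range K, rawMembership (n + 1) d (argMin d K) j) ^ n := by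
      intro k hk
      have hdk : 0 < d k := (not_le.1 (not_or.1 h).2).trans_le (argMin_le d hk)
      have hn : n ≠ 0 := by rintro rfl; exact h (Or.inl le_rfl)
      have hq : 0 ≤ d (argMin d K) / d k := div_nonneg (hd _ hb) hdk.le
      rw [optMembership, div_pow, rawMembership, if_neg h, max_eq_left hq, Nat.add_sub_cancel,
        one_div, Real.rpow_inv_natCast_pow hq hn]
      field_simp
    exact sum_pow_mul_le_of_kkt hd (fun k _ => hnn k) hr (hsum.trans hs.symm)
      (fun k hk => (key k hk).ge) fun k hk _ => key k hk

/-! Centroids. -/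

section Centroid

variable {N : ℕ} {E : Type*} [NormedAddCommGroup E] [InnerProductSpace ℝ E]

/-- The weighted centroid. -/
def centroid (a : Fin N → ℝ) (x : Fin N → E) : E := (∑ n, a n)⁻¹ • ∑ n, a n • x n

theorem sum_smul_sub_centroid {a : Fin N → ℝ} (ha : ∑ n, a n ≠ 0) (x : Fin N → E) :
    ∑ n, a n • (x n - centroid a x) = 0 := by
  simp only [smul_sub, Finset.sum_sub_distrib, ← Finset.sum_smul]
  rw [centroid, smul_smul, mul_inv_cancel₀ ha, one_smul, sub_self]

/-- The parallel axis theorem. -/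
theorem sum_mul_norm_sub_sq {a : Fin N → ℝ} (ha : ∑ n, a n ≠ 0) (x : Fin N → E) (v : E) :
    ∑ n, a n * ‖x n - v‖ ^ 2 =
      ∑ n, a n * ‖x n - centroid a x‖ ^ 2 + (∑ n, a n) * ‖v - centroid a x‖ ^ 2 := by
  have h : ∀ n, a n * ‖x n - v‖ ^ 2 = a n * ‖x n - centroid a x‖ ^ 2
      - 2 * inner ℝ (a n • (x n - centroid a x)) (v - centroid a x)
      + a n * ‖v - centroid a x‖ ^ 2 := by
    intro n
    rw [← sub_sub_sub_cancel_right (x n) v (centroid a x), norm_sub_sq_real, real_inner_smul_left]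
    ring
  simp only [h, Finset.sum_add_distrib, Finset.sum_sub_distrib, ← Finset.mul_sum, ← sum_inner,
    sum_smul_sub_centroid ha, inner_zero_left, ← Finset.sum_mul]
  ring

theorem sum_mul_norm_sub_centroid_le {a : Fin N → ℝ} (h0 : ∀ n, 0 ≤ a n) (ha : ∑ n, a n ≠ 0)
    (x : Fin N → E) (v : E) :
    ∑ n, a n * ‖x n - centroid a x‖ ^ 2 ≤ ∑ n, a n * ‖x n - v‖ ^ 2 := by
  rw [sum_mul_norm_sub_sq ha x v]
  have := Finset.sum_nonneg fun n (_ : n ∈ Finset.univ) => h0 n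
  have : 0 ≤ (∑ n, a n) * ‖v - centroid a x‖ ^ 2 := by positivity
  linarith

end Centroid

/-! Existence of optimal solutions. -/

theorem cost_eq_sum_clusters {N D L : ℕ} (m : ℕ) (x : Fin N → EuclideanSpace ℝ (Fin D))
    (w : Fin N → ℝ) (μ : Fin L → EuclideanSpace ℝ (Fin D)) (r : Fin N → Fin L → ℝ) :
    cost m x w μ r = ∑ l, ∑ n, r n l ^ m * w n * ‖x n - μ l‖ ^ 2 := Finset.sum_comm

/-- Moving the means to the centroids never raises the cost, so it suffices to minimize over the
memberships alone. Balanced memberships form a compact set, and `0 < R` keeps the denominators of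
the centroids away from zero, which makes the cost continuous there. -/
theorem exists_optimal_with_clusters {N D L : ℕ} (m : ℕ) (x : Fin N → EuclideanSpace ℝ (Fin D))
    {w : Fin N → ℝ} (hw : ∀ n, 0 ≤ w n) {R : ℝ} (hR : 0 < R) {K : ℕ}
    (hf : ∃ r : Fin N → Fin L → ℝ, IsMembership r ∧ IsBalanced m w R K r) :
    ∃ (μ : Fin L → EuclideanSpace ℝ (Fin D)) (r : Fin N → Fin L → ℝ),
      IsMembership r ∧ IsBalanced m w R K r ∧
      ∀ (μ' : Fin L → EuclideanSpace ℝ (Fin D)) (r' : Fin N → Fin L → ℝ),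
      IsMembership r' → IsBalanced m w R K r' → cost m x w μ r ≤ cost m x w μ' r' := by
  set S : Set (Fin N → Fin L → ℝ) := {r | IsMembership r ∧ IsBalanced m w R K r} with hS
  set c : (Fin N → Fin L → ℝ) → Fin L → EuclideanSpace ℝ (Fin D) :=
    fun r l => centroid (fun n => r n l ^ m * w n) x with hc
  have hpos : ∀ r ∈ S, ∀ l, ∑ n, r n l ^ m * w n ≠ 0 := fun r hr l =>
    (hR.trans_le (hr.2.2 l)).ne'
  have hcompact : IsCompact S := by
    have hK : IsCompact (Set.univ.pi fun _ : Fin N => Set.univ.pi fun _ : Fin L =>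
      Set.Icc (0 : ℝ) 1) := isCompact_univ_pi fun _ => isCompact_univ_pi fun _ => isCompact_Icc
    refine hK.of_isClosed_subset ?_ fun r hr => fun n _ l _ => hr.1.1 n l
    simp only [hS, IsMembership, IsBalanced, clusterWeight]
    by_cases hL : L ≤ K
    · simp only [hL, true_and, Set.ofPred_and, Set.ofPred_forall]
      refine (IsClosed.inter ?_ ?_).inter ?_
      · exact isClosed_iInter fun n => isClosed_iInter fun l =>
          isClosed_Icc.preimage (by fun_prop)
      · exact isClosed_iInter fun n => isClosed_eq (by fun_prop) (by fun_prop)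
      · exact isClosed_iInter fun l => isClosed_le (by fun_prop) (by fun_prop)
    · simp [hL]
  have hcont : ContinuousOn (fun r => cost m x w (c r) r) S := by
    unfold cost
    refine continuousOn_finsetSum _ fun n _ => continuousOn_finsetSum _ fun l _ => ?_
    refine ContinuousOn.mul (by fun_prop) ((ContinuousOn.norm ?_).pow 2)
    refine continuousOn_const.sub ?_
    simp only [hc, centroid]
    exact ContinuousOn.smul (ContinuousOn.inv₀ (by fun_prop) fun r hr => hpos r hr l)
      (by fun_prop)
  obtain ⟨r, hr, hmin⟩ := hcompact.exists_isMinOn hf hcont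
  refine ⟨c r, r, hr.1, hr.2, fun μ' r' h1 h2 => (hmin (⟨h1, h2⟩ : r' ∈ S)).trans ?_⟩
  simp only [cost_eq_sum_clusters]
  refine Finset.sum_le_sum fun l _ => ?_
  exact sum_mul_norm_sub_centroid_le
    (fun n => mul_nonneg (pow_nonneg (h1.1 n l).1 _) (hw n)) (hpos r' ⟨h1, h2⟩ l) x (μ' l)

theorem isMembership_one {N : ℕ} : IsMembership fun (_ : Fin N) (_ : Fin 1) => (1 : ℝ) := by
  simp [IsMembership]

/-- Only finitely many numbers of clusters `L ≤ K` compete, and `L = 1` is feasible because `α ≤ 1`.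
If the total weight is zero, every solution costs `0`. -/
theorem exists_isOptimalBalanced {N D K : ℕ} (hK : 1 ≤ K) (m : ℕ)
    (x : Fin N → EuclideanSpace ℝ (Fin D)) {w : Fin N → ℝ} (hw : ∀ n, 0 ≤ w n) {α : ℝ}
    (h0 : 0 < α) (h1 : α ≤ 1) :
    ∃ (L : ℕ) (μ : Fin L → EuclideanSpace ℝ (Fin D)) (r : Fin N → Fin L → ℝ),
      IsOptimalBalanced m x w (α * ∑ n, w n) K μ r := by
  have hW : 0 ≤ ∑ n, w n := Finset.sum_nonneg fun n _ => hw n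
  have hbal : IsBalanced m w (α * ∑ n, w n) K fun (_ : Fin N) (_ : Fin 1) => (1 : ℝ) := by
    refine ⟨hK, fun l => ?_⟩
    simp only [clusterWeight, one_pow, one_mul]
    exact mul_le_of_le_one_left hW h1
  rcases hW.eq_or_lt with hW0 | hW0
  · have hz : ∀ n, w n = 0 := by
      have := (Finset.sum_eq_zero_iff_of_nonneg fun n _ => hw n).1 hW0.symm
      simpa using this
    exact ⟨1, 0, _, isMembership_one, hbal, fun L' μ' r' _ _ => by simp [cost, hz]⟩
  classical
  set F : Finset ℕ := (Finset.range (K + 1)).filter fun L =>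
    ∃ r : Fin N → Fin L → ℝ, IsMembership r ∧ IsBalanced m w (α * ∑ n, w n) K r with hF
  have hF1 : F.Nonempty := ⟨1, by
    simp only [hF, Finset.mem_filter, Finset.mem_range]
    exact ⟨by omega, _, isMembership_one, hbal⟩⟩
  have hFv : ∀ L : ℕ, L ∈ F → ∃ v : ℝ, ∃ (μ : Fin L → EuclideanSpace ℝ (Fin D))
      (r : Fin N → Fin L → ℝ), cost m x w μ r = v ∧ IsMembership r ∧
      IsBalanced m w (α * ∑ n, w n) K r ∧
      ∀ (μ' : Fin L → EuclideanSpace ℝ (Fin D)) (r' : Fin N → Fin L → ℝ),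
      IsMembership r' → IsBalanced m w (α * ∑ n, w n) K r' → v ≤ cost m x w μ' r' := by
    intro L hL
    obtain ⟨μ, r, h1, h2, h3⟩ := exists_optimal_with_clusters m x hw (mul_pos h0 hW0)
      (Finset.mem_filter.1 hL).2
    exact ⟨_, μ, r, rfl, h1, h2, h3⟩
  choose! v hv using hFv
  obtain ⟨L, hL, hmin⟩ := Finset.exists_min_image F v hF1
  obtain ⟨μ, r, he, h1, h2, h3⟩ := hv L hL
  refine ⟨L, μ, r, h1, h2, fun L' μ' r' h1' h2' => ?_⟩
  have hL' : L' ∈ F := by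
    simp only [hF, Finset.mem_filter, Finset.mem_range]
    exact ⟨by have := h2'.1; omega, r', h1', h2'⟩
  obtain ⟨_, _, _, _, _, h3'⟩ := hv L' hL'
  rw [he]
  exact (hmin L' hL').trans (h3' μ' r' h1' h2')

end FuzzyKMeans

namespace RealRAM

open Finset (range)

/-! The program. -/

/-- The integer variable `a`. -/
abbrev ivar (a : ℕ) : IExpr := .load a (.const 0)

/-- The real variable `a`. -/
abbrev rvar (a : ℕ) : RExpr := .load a (.const 0)

abbrev numPoints : IExpr := .load 0 (.const 0)

abbrev dimension : IExpr := .load 0 (.const 1)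

abbrev numClusters : IExpr := .load 0 (.const 2)

abbrev fuzzifier : IExpr := .load 0 (.const 3)

abbrev numSamples : IExpr := .load 1 (.const 0)

abbrev numTrials : IExpr := .load 1 (.const 1)

/-- The squared distance of point `n` and mean `k`. -/
def sqDist (P : Params) (M : ℕ → ℝ) (n k : ℕ) : ℝ :=
  ∑ d ∈ range P.D, (P.x (n * P.D + d) - M (k * P.D + d)) ^ 2

/-- Compute the squared distances of the current point to the means in real array `a`. -/
def distRow (a : ℕ) : Cmd :=
  forTo 5 numClusters (.seq (.rset 8 (.const 0) (.ofInt (.const 0)))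
    (.seq (forTo 6 dimension (.rset 8 (.const 0) (.add (rvar 8)
      (.pow (.sub (.load 2 (.add (.mul (ivar 4) dimension) (ivar 6)))
        (.load a (.add (.mul (ivar 5) dimension) (ivar 6)))) (.const 2)))))
    (.rset 7 (ivar 5) (rvar 8))))

/-- Array `3` holds the best means so far, array `5` those of the current trial. -/
theorem runs_distRow {ω : Tape} {P : Params} {σ : State} (hσ : Env P σ) {a : ℕ}
    (ha : a = 3 ∨ a = 5) :
    Runs ω (distRow a) σ (P.K * (100 + P.D * 100) + 100) fun τ => Env P τ ∧
      ∀ k < P.K, τ.reals 7 k = sqDist P (σ.reals a) (σ.ints 4 0) k := by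
  refine Runs.weaken (Runs.forTo (B := 80 + P.D * 80) P.K (fun i ρ => ∀ k < i, ρ.reals 7 k =
    sqDist P (σ.reals a) (σ.ints 4 0) k) hσ (fun ρ h => h.hK) rfl rfl (by simp)
    fun k hk ρ hE hS hk' hI => ?_) ?_
  rotate_left
  · simp [IExpr.steps]
    nlinarith
  · refine Runs.weaken (Runs.seq_rset (Runs.seq (Runs.forTo P.D (fun i ρ' => ρ'.reals 8 0 =
      ∑ d ∈ range i, (P.x (σ.ints 4 0 * P.D + d) - σ.reals a (k * P.D + d)) ^ 2)
      (hE.setReal _ _ _ (by decide) (by decide) (by decide)) (fun ρ h => h.hD) rfl rfl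
      (by simp [RExpr.eval, IExpr.eval]) fun d hd ρ' hE' hS' hd' hI' => Runs.rset ?_)
      fun τ hS' hI' => Runs.rset ?_)) ?_
    · have h4 : ρ'.ints 4 = σ.ints 4 := (hS'.ints 4 rfl).trans (hS.ints 4 rfl)
      have h5 : ρ'.ints 5 0 = k := by rw [hS'.ints 5 rfl]; exact hk'
      have h6 : ρ'.reals a = σ.reals a := by
        rcases ha with rfl | rfl
        · exact (hS'.reals 3 rfl).trans ((setReal_reals_ne _ _ _ (by decide)).trans
            (hS.reals 3 rfl))
        · exact (hS'.reals 5 rfl).trans ((setReal_reals_ne _ _ _ (by decide)).trans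
            (hS.reals 5 rfl))
      simp [RExpr.eval, IExpr.eval, hI', h4, h5, h6, hd', hE'.hD, hE'.hx, Finset.sum_range_succ]
    · have h5 : τ.ints 5 0 = k := by rw [hS'.ints 5 rfl]; exact hk'
      have h7 : τ.reals 7 = ρ.reals 7 :=
        (hS'.reals 7 rfl).trans (setReal_reals_ne _ _ _ (by decide))
      intro j hj
      simp only [IExpr.eval, RExpr.eval, h5, h7, hI'.2, setReal_reals, setInt_reals, true_and]
      split_ifs with hjk
      · rw [hjk, sqDist]
      · exact hI j (by omega)
    · simp [IExpr.steps, RExpr.steps]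
      omega

/-- Find the nearest mean of the current point. -/
def nearestRow : Cmd :=
  .seq (.iset 10 (.const 0) (.const 0))
    (forTo 5 numClusters
      (.cond (.not (.rle (.load 7 (ivar 10)) (.load 7 (ivar 5))))
        (.iset 10 (.const 0) (ivar 5)) .skip))

theorem runs_nearestRow {ω : Tape} {P : Params} {σ : State} (hσ : Env P σ) :
    Runs ω nearestRow σ (P.K * 100 + 100) fun τ => Env P τ ∧
      τ.ints 10 0 = FuzzyKMeans.argMin (σ.reals 7) P.K := by
  refine Runs.weaken (Runs.seq_iset (Runs.forTo (B := 50) P.K (fun i ρ =>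
    ρ.ints 10 0 = FuzzyKMeans.argMin (σ.reals 7) i) (hσ.setInt _ _ _ (by decide) (by decide))
    (fun ρ h => h.hK) rfl rfl (by simp [IExpr.eval, FuzzyKMeans.argMin])
    fun k hk ρ hE hS hk' hI => ?_)) ?_
  · have h7 : ρ.reals 7 = σ.reals 7 := hS.reals 7 rfl
    refine Runs.weaken (Runs.cond (fun hb => Runs.iset ?_) fun hb => Runs.skip ?_) ?_
    · simp only [BExpr.Holds, RExpr.eval, IExpr.eval, h7, hk', hI, not_le] at hb
      simp [IExpr.eval, FuzzyKMeans.argMin, hb, hk']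
    · simp only [BExpr.Holds, RExpr.eval, IExpr.eval, h7, hk', hI, not_not] at hb
      simp [FuzzyKMeans.argMin, hb.not_gt, hI]
    · simp [IExpr.steps, BExpr.steps, RExpr.steps]
  · simp [IExpr.steps]
    omega

/-- Compute the unnormalized memberships of the current point and their sum. -/
def rawRow : Cmd :=
  .seq (.rset 12 (.const 0) (.ofInt (.const 0)))
    (forTo 5 numClusters (.seq
      -- The disjunction in `rawMembership`, by De Morgan; the test `k = b` below it becomes two
      -- inequalities.
      (.cond (.not (.and (.not (.ile fuzzifier (.const 1)))
          (.not (.rle (.load 7 (ivar 10)) (.ofInt (.const 0))))))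
        (.cond (.and (.ile (ivar 5) (ivar 10)) (.ile (ivar 10) (ivar 5)))
          (.rset 14 (ivar 5) (.ofInt (.const 1))) (.rset 14 (ivar 5) (.ofInt (.const 0))))
        (.rset 14 (ivar 5) (.root (.sub fuzzifier (.const 1))
          (.div (.load 7 (ivar 10)) (.load 7 (ivar 5))))))
      (.rset 12 (.const 0) (.add (rvar 12) (.load 14 (ivar 5))))))

theorem runs_rawRow {ω : Tape} {P : Params} {σ : State} (hσ : Env P σ) :
    Runs ω rawRow σ (P.K * 100 + 100) fun τ => Env P τ ∧
      τ.reals 12 0 = ∑ k ∈ range P.K,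
        FuzzyKMeans.rawMembership P.m (σ.reals 7) (σ.ints 10 0) k ∧
      ∀ k < P.K, τ.reals 14 k =
        FuzzyKMeans.rawMembership P.m (σ.reals 7) (σ.ints 10 0) k := by
  refine Runs.weaken (Runs.seq_rset (Runs.forTo (B := 75) P.K (fun i ρ =>
    ρ.reals 12 0 = ∑ k ∈ range i,
      FuzzyKMeans.rawMembership P.m (σ.reals 7) (σ.ints 10 0) k ∧
    ∀ k < i, ρ.reals 14 k = FuzzyKMeans.rawMembership P.m (σ.reals 7) (σ.ints 10 0) k)
    (hσ.setReal _ _ _ (by decide) (by decide) (by decide))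
    (fun ρ h => h.hK) rfl rfl (by simp [IExpr.eval, RExpr.eval])
    fun k hk ρ hE hS hk' hI => ?_)) ?_
  · have h7 : ρ.reals 7 = σ.reals 7 :=
      (hS.reals 7 rfl).trans (setReal_reals_ne _ _ _ (by decide))
    have h10 : ρ.ints 10 = σ.ints 10 := hS.ints 10 rfl
    refine Runs.weaken (Runs.seq (R := fun τ => τ = ρ.setReal 14 k
      (FuzzyKMeans.rawMembership P.m (σ.reals 7) (σ.ints 10 0) k))
      (Runs.cond (fun hb => Runs.cond (fun hc => Runs.rset ?_) (fun hc => Runs.rset ?_))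
        fun hb => Runs.rset ?_) fun τ hS' hI' => Runs.rset ?_) ?_
    · simp only [BExpr.Holds, RExpr.eval, IExpr.eval, h7, hk', hE.hm, h10, Nat.cast_zero] at hb hc
      rw [FuzzyKMeans.rawMembership, if_pos (by tauto), if_pos (by omega)]
      simp [IExpr.eval, RExpr.eval, hk']
    · simp only [BExpr.Holds, RExpr.eval, IExpr.eval, h7, hk', hE.hm, h10, Nat.cast_zero] at hb hc
      rw [FuzzyKMeans.rawMembership, if_pos (by tauto), if_neg (by omega)]
      simp [IExpr.eval, RExpr.eval, hk']
    · simp only [BExpr.Holds, RExpr.eval, IExpr.eval, h7, hE.hm, h10, Nat.cast_zero] at hb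
      rw [FuzzyKMeans.rawMembership, if_neg (by tauto)]
      simp [IExpr.eval, RExpr.eval, hk', h7, h10, hE.hm]
    · subst hI'
      refine ⟨by simp [IExpr.eval, RExpr.eval, hk', hI.1, Finset.sum_range_succ], fun j hj => ?_⟩
      simp only [IExpr.eval, RExpr.eval, setReal_reals, setInt_reals]
      by_cases hjk : j = k
      · simp [hjk]
      · simp [hjk, hI.2 j (by omega)]
    · simp [IExpr.steps, BExpr.steps, RExpr.steps]
  · simp [IExpr.steps, RExpr.steps]
    omega

/-- Store the memberships of the current point and add its contribution to the cost. -/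
def normalizeRow : Cmd :=
  forTo 5 numClusters (.seq
    (.rset 4 (.add (.mul (ivar 4) numClusters) (ivar 5)) (.div (.load 14 (ivar 5)) (rvar 12)))
    (.rset 9 (.const 0) (.add (rvar 9) (.mul (.mul
      (.pow (.load 4 (.add (.mul (ivar 4) numClusters) (ivar 5))) fuzzifier)
      (.load 1 (ivar 4))) (.load 7 (ivar 5))))))

/-- That the rows of earlier points survive in array `4` is what the loop over all points needs. -/
theorem runs_normalizeRow {ω : Tape} {P : Params} {σ : State} (hσ : Env P σ) :
    Runs ω normalizeRow σ (P.K * 100 + 100) fun τ => Env P τ ∧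
      (∀ k < P.K, τ.reals 4 (σ.ints 4 0 * P.K + k) = σ.reals 14 k / σ.reals 12 0) ∧
      (∀ i < σ.ints 4 0 * P.K, τ.reals 4 i = σ.reals 4 i) ∧
      τ.reals 9 0 = σ.reals 9 0 + ∑ k ∈ range P.K,
        (σ.reals 14 k / σ.reals 12 0) ^ P.m * P.w (σ.ints 4 0) * σ.reals 7 k := by
  refine Runs.weaken (Runs.forTo (B := 75) P.K (fun i ρ =>
    (∀ k < i, ρ.reals 4 (σ.ints 4 0 * P.K + k) = σ.reals 14 k / σ.reals 12 0) ∧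
      (∀ j < σ.ints 4 0 * P.K, ρ.reals 4 j = σ.reals 4 j) ∧
      ρ.reals 9 0 = σ.reals 9 0 + ∑ k ∈ range i,
        (σ.reals 14 k / σ.reals 12 0) ^ P.m * P.w (σ.ints 4 0) * σ.reals 7 k)
    hσ (fun ρ h => h.hK) rfl rfl (by simp)
    fun k hk ρ hE hS hk' hI => ?_) ?_
  · have h4 : ρ.ints 4 = σ.ints 4 := hS.ints 4 rfl
    have h7 : ρ.reals 7 = σ.reals 7 := hS.reals 7 rfl
    have h12 : ρ.reals 12 = σ.reals 12 := hS.reals 12 rfl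
    have h14 : ρ.reals 14 = σ.reals 14 := hS.reals 14 rfl
    obtain ⟨hI1, hI2, hI3⟩ := hI
    refine Runs.weaken (Runs.seq_rset (Runs.rset ?_)) ?_
    · refine ⟨fun j hj => ?_, fun j hj => ?_, ?_⟩
      · by_cases hjk : j = k
        · simp [IExpr.eval, RExpr.eval, h4, h12, h14, hk', hE.hK, hjk]
        · simp [IExpr.eval, RExpr.eval, h4, hk', hE.hK, hjk, hI1 j (by omega)]
      · have hjk : j ≠ σ.ints 4 0 * P.K + k := by omega
        simp [IExpr.eval, RExpr.eval, h4, hk', hE.hK, hjk, hI2 j hj]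
      · simp [IExpr.eval, RExpr.eval, h4, h7, h12, h14, hk', hE.hK, hE.hm, hE.hw, hI3,
          Finset.sum_range_succ, add_assoc]
    · simp [IExpr.steps, RExpr.steps]
  · simp [IExpr.steps]
    omega

/-- The cost of the given means with optimal memberships. -/
def optCost (P : Params) (M : ℕ → ℝ) : ℝ :=
  ∑ n ∈ range P.N, ∑ k ∈ range P.K,
    FuzzyKMeans.optMembership P.m P.K (sqDist P M n) k ^ P.m * P.w n * sqDist P M n k

/-- Compute optimal memberships for the means in real array `a`, and the resulting cost. -/
def evalMeans (a : ℕ) : Cmd :=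
  .seq (.rset 9 (.const 0) (.ofInt (.const 0)))
    (forTo 4 numPoints (.seq (distRow a) (.seq nearestRow (.seq rawRow normalizeRow))))

/-- Only the first `K` cells of a distance row are controlled, so everything computed from a row
must be shown to depend on these cells alone. -/
theorem _root_.FuzzyKMeans.argMin_congr {d e : ℕ → ℝ} {K : ℕ} (h : ∀ k < K, d k = e k) :
    FuzzyKMeans.argMin d K = FuzzyKMeans.argMin e K := by
  induction K with
  | zero => rfl
  | succ K ih =>
    have ih := ih fun k hk => h k (by omega)
    -- The default `argMin d 0 = 0` is not an index below `0`; there the next step compares `d 0`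
    -- with itself.
    rcases Nat.eq_zero_or_pos K with rfl | hK
    · simp [FuzzyKMeans.argMin]
    · have := FuzzyKMeans.argMin_lt e hK
      rw [FuzzyKMeans.argMin, FuzzyKMeans.argMin, ih, h K (by omega), h _ (by omega)]

theorem _root_.FuzzyKMeans.rawMembership_congr {d e : ℕ → ℝ} {m K b k : ℕ}
    (h : ∀ k < K, d k = e k) (hb : b < K) (hk : k < K) :
    FuzzyKMeans.rawMembership m d b k = FuzzyKMeans.rawMembership m e b k := by
  rw [FuzzyKMeans.rawMembership, FuzzyKMeans.rawMembership, h b hb, h k hk]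

theorem _root_.FuzzyKMeans.optMembership_congr {d e : ℕ → ℝ} {m K k : ℕ}
    (h : ∀ k < K, d k = e k) (hk : k < K) :
    FuzzyKMeans.optMembership m K d k = FuzzyKMeans.optMembership m K e k := by
  have hb := FuzzyKMeans.argMin_lt e (K := K) (by omega)
  rw [FuzzyKMeans.optMembership, FuzzyKMeans.optMembership, FuzzyKMeans.argMin_congr h,
    FuzzyKMeans.rawMembership_congr h hb hk]
  congr 1
  exact Finset.sum_congr rfl fun j hj =>
    FuzzyKMeans.rawMembership_congr h hb (Finset.mem_range.1 hj)

theorem optCost_congr {P : Params} {M M' : ℕ → ℝ}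
    (h : ∀ k < P.K, ∀ d < P.D, M (k * P.D + d) = M' (k * P.D + d)) :
    optCost P M = optCost P M' := by
  have hd : ∀ n, ∀ k < P.K, sqDist P M n k = sqDist P M' n k := fun n k hk =>
    Finset.sum_congr rfl fun d hd => by rw [h k hk d (Finset.mem_range.1 hd)]
  refine Finset.sum_congr rfl fun n _ => Finset.sum_congr rfl fun k hk => ?_
  have hk := Finset.mem_range.1 hk
  rw [FuzzyKMeans.optMembership_congr (hd n) hk, hd n k hk]

theorem runs_evalMeans {ω : Tape} {P : Params} {σ : State} (hσ : Env P σ) {a : ℕ}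
    (ha : a = 3 ∨ a = 5) :
    Runs ω (evalMeans a) σ (P.N * (P.K * (400 + P.D * 100) + 450) + 100) fun τ => Env P τ ∧
      τ.reals 9 0 = optCost P (σ.reals a) ∧
      ∀ n < P.N, ∀ k < P.K, τ.reals 4 (n * P.K + k) =
        FuzzyKMeans.optMembership P.m P.K (sqDist P (σ.reals a) n) k := by
  refine Runs.weaken (Runs.seq_rset (Runs.forTo (B := P.K * (400 + P.D * 100) + 400) P.N
    (fun i ρ =>
      ρ.reals 9 0 = ∑ n ∈ range i, ∑ k ∈ range P.K,
        FuzzyKMeans.optMembership P.m P.K (sqDist P (σ.reals a) n) k ^ P.m * P.w n *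
          sqDist P (σ.reals a) n k ∧
      ∀ n < i, ∀ k < P.K, ρ.reals 4 (n * P.K + k) =
        FuzzyKMeans.optMembership P.m P.K (sqDist P (σ.reals a) n) k)
    (hσ.setReal _ _ _ (by decide) (by decide) (by decide)) (fun ρ h => h.hN) rfl rfl
    (by simp [RExpr.eval, IExpr.eval]) fun n hn ρ hE hS hn' hI => ?_)) ?_
  · have hM : ρ.reals a = σ.reals a := by
      rcases ha with rfl | rfl
      · exact (hS.reals 3 rfl).trans (setReal_reals_ne _ _ _ (by decide))
      · exact (hS.reals 5 rfl).trans (setReal_reals_ne _ _ _ (by decide))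
    refine Runs.weaken (Runs.seq (runs_distRow hE ha) fun ρ1 hS1 h1 =>
      Runs.seq (runs_nearestRow h1.1) fun ρ2 hS2 h2 =>
      Runs.seq (runs_rawRow h2.1) fun ρ3 hS3 h3 =>
      Runs.mono (runs_normalizeRow h3.1) le_rfl fun τ hS4 h4 => ?_) ?_
    · obtain ⟨-, h1⟩ := h1
      obtain ⟨-, h2⟩ := h2
      obtain ⟨-, h3a, h3b⟩ := h3
      obtain ⟨-, h4a, h4b, h4c⟩ := h4
      have e7 : ρ2.reals 7 = ρ1.reals 7 := hS2.reals 7 rfl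
      have e7' : ρ3.reals 7 = ρ1.reals 7 := (hS3.reals 7 rfl).trans e7
      have e4 : ρ3.ints 4 0 = n := by
        rw [hS3.ints 4 rfl, hS2.ints 4 rfl, hS1.ints 4 rfl, hn']
      have e9 : ρ3.reals 9 = ρ.reals 9 := by
        rw [hS3.reals 9 rfl, hS2.reals 9 rfl, hS1.reals 9 rfl]
      have e4' : ρ3.reals 4 = ρ.reals 4 := by
        rw [hS3.reals 4 rfl, hS2.reals 4 rfl, hS1.reals 4 rfl]
      rw [hn', hM] at h1
      rw [e7, h2] at h3a h3b
      have hq : ∀ k < P.K, ρ3.reals 14 k / ρ3.reals 12 0 =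
          FuzzyKMeans.optMembership P.m P.K (sqDist P (σ.reals a) n) k := by
        intro k hk
        rw [h3a, h3b k hk, ← FuzzyKMeans.optMembership_congr h1 hk]
        rfl
      refine ⟨?_, fun n' hn'' k hk => ?_⟩
      · rw [setInt_reals, h4c, Finset.sum_range_succ, e9, hI.1, e4, e7']
        congr 1
        refine Finset.sum_congr rfl fun k hk => ?_
        have hk := Finset.mem_range.1 hk
        rw [hq k hk, h1 k hk]
      · rw [setInt_reals]
        rcases Nat.lt_succ_iff_lt_or_eq.1 hn'' with hlt | rfl
        · rw [h4b _ (by rw [e4]; nlinarith [Nat.mul_le_mul_right P.K hlt]), e4', hI.2 n' hlt k hk]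
        · rw [← hq k hk, ← h4a k hk, e4]
    · exact le_of_eq (by ring)
  · simp [IExpr.steps, RExpr.steps]
    nlinarith

end RealRAM

namespace RealRAM

open Finset (range)

/-! Sampling. -/

/-- The index of the point that the number `u` selects. -/
def pickIndex (P : Params) (u : ℝ) : ℕ :=
  -- Inverse transform sampling: count the partial sums of the weights below `u * W`. Leaving out
  -- the last one keeps the index below `N` for every `u`.
  ∑ n ∈ range (P.N - 1), if ∑ i ∈ range (n + 1), P.w i < u * P.W then 1 else 0

/-- Draw the index of a point. -/
def pick : Cmd :=
  .seq (.draw 11 (.const 0)) (.seq (.iset 8 (.const 0) (.const 0))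
    (.seq (.rset 8 (.const 0) (.ofInt (.const 0)))
    (forTo 4 (.sub numPoints (.const 1))
      (.seq (.rset 8 (.const 0) (.add (rvar 8) (.load 1 (ivar 4))))
        (.cond (.not (.rle (.mul (rvar 11) (rvar 6)) (rvar 8)))
          (.iset 8 (.const 0) (.add (ivar 8) (.const 1))) .skip)))))

theorem runs_pick {ω : Tape} {P : Params} {σ : State} (hσ : Env P σ) :
    Runs ω pick σ (P.N * 100 + 100) fun τ => Env P τ ∧ τ.pos = σ.pos + 1 ∧
      τ.ints 8 0 = pickIndex P (ω σ.pos) := by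
  set σ' : State := { σ.setReal 11 0 (ω σ.pos : ℝ) with pos := σ.pos + 1 } with hσ'
  have hσ'' : Env P σ' := by
    obtain ⟨a1, a2, a3, a4, a5, a6, a7, a8, a9⟩ :=
      hσ.setReal 11 0 (ω σ.pos : ℝ) (by decide) (by decide) (by decide)
    exact ⟨a1, a2, a3, a4, a5, a6, a7, a8, a9⟩
  have hu : σ'.reals 11 0 = ω σ.pos := by
    change (σ.setReal 11 0 (ω σ.pos : ℝ)).reals 11 0 = _
    simp
  refine Runs.weaken (Runs.seq_draw (Runs.seq_iset (Runs.seq_rset (Runs.mono (Runs.forTo (B := 50)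
    (P.N - 1) (fun i ρ => ρ.reals 8 0 = ∑ j ∈ range i, P.w j ∧ ρ.ints 8 0 = ∑ n ∈ range i,
      if ∑ j ∈ range (n + 1), P.w j < ω σ.pos * P.W then 1 else 0)
    ((hσ''.setInt 8 0 0 (by decide) (by decide)).setReal 8 0 _ (by decide) (by decide) (by decide))
    (fun ρ h => by simp [IExpr.eval, h.hN]) rfl rfl ?_
    fun n hn ρ hE hS hn' hI => ?_) le_rfl fun τ hS hτ => ?_)))) ?_
  · simp [IExpr.eval, RExpr.eval]
  · have h11 : ρ.reals 11 = σ'.reals 11 := by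
      rw [hS.reals 11 rfl]
      simp only [IExpr.eval, RExpr.eval, Nat.cast_zero]
      rw [setReal_reals_ne _ _ _ (by decide)]
      rfl
    obtain ⟨hI1, hI2⟩ := hI
    refine Runs.weaken (Runs.seq_rset (Runs.cond (fun hb => Runs.iset ?_)
      fun hb => Runs.skip ?_)) ?_
    · simp [BExpr.Holds, RExpr.eval, IExpr.eval, hn', hE.hw, hE.hW, h11, hu, hI1,
        ← Finset.sum_range_succ] at hb
      simp [RExpr.eval, IExpr.eval, hn', hE.hw, hI1, hI2, ← Finset.sum_range_succ,
        -Finset.sum_boole]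
      rw [Finset.sum_range_succ _ n, if_pos hb]
    · simp [BExpr.Holds, RExpr.eval, IExpr.eval, hn', hE.hw, hE.hW, h11, hu, hI1,
        ← Finset.sum_range_succ] at hb
      simp [RExpr.eval, IExpr.eval, hn', hE.hw, hI1, hI2, ← Finset.sum_range_succ,
        -Finset.sum_boole]
      rw [Finset.sum_range_succ _ n, if_neg hb.not_gt, add_zero]
    · simp [IExpr.steps, RExpr.steps, BExpr.steps]
  · exact ⟨hτ.1, by rw [hS.pos rfl]; rfl, hτ.2.2⟩
  · simp [IExpr.steps, RExpr.steps]
    omega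

/-- Draw the indices of the points for all means. -/
def drawIndices : Cmd :=
  forTo 3 (.mul numClusters numSamples) (.seq pick (.iset 9 (ivar 3) (ivar 8)))

theorem runs_drawIndices {ω : Tape} {P : Params} {σ : State} (hσ : Env P σ) :
    Runs ω drawIndices σ (P.K * P.s * (P.N * 100 + 200) + 100) fun τ => Env P τ ∧
      τ.pos = σ.pos + P.K * P.s ∧
      ∀ i < P.K * P.s, τ.ints 9 i = pickIndex P (ω (σ.pos + i)) := by
  refine Runs.weaken (Runs.forTo (B := P.N * 100 + 150) (P.K * P.s)
    (fun i ρ => ρ.pos = σ.pos + i ∧ ∀ j < i, ρ.ints 9 j = pickIndex P (ω (σ.pos + j)))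
    hσ (fun ρ h => by simp [IExpr.eval, h.hK, h.hs]) rfl rfl (by simp)
    fun i hi ρ hE hS hi' hI => ?_) ?_
  · refine Runs.weaken (Runs.seq (runs_pick hE) fun ρ1 hS1 h1 => Runs.iset ?_) ?_
    · have h3 : ρ1.ints 3 0 = i := by rw [hS1.ints 3 rfl, hi']
      have h9 : ρ1.ints 9 = ρ.ints 9 := hS1.ints 9 rfl
      refine ⟨by simp [h1.2.1, hI.1, add_assoc], fun j hj => ?_⟩
      by_cases hji : j = i
      · simp [IExpr.eval, h3, hji, h1.2.2, hI.1]
      · simp [IExpr.eval, h3, hji, h9, hI.2 j (by omega)]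
    · simp [IExpr.steps]
  · simp [IExpr.steps]
    nlinarith

/-- Compute the means of the sampled points. -/
def averageSamples : Cmd :=
  forTo 5 numClusters (forTo 6 dimension
    (.seq (.rset 8 (.const 0) (.ofInt (.const 0)))
    (.seq (forTo 7 numSamples (.rset 8 (.const 0) (.add (rvar 8) (.load 2
      (.add (.mul (.load 9 (.add (.mul (ivar 5) numSamples) (ivar 7))) dimension) (ivar 6))))))
    (.rset 5 (.add (.mul (ivar 5) dimension) (ivar 6)) (.div (rvar 8) (.ofInt numSamples))))))

/-- Row-major addressing is injective; this serves for array cells as well as for tape positions. -/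
theorem mul_add_inj {D k k' d d' : ℕ} (hd : d < D) (hd' : d' < D) :
    k * D + d = k' * D + d' ↔ k = k' ∧ d = d' := by
  refine ⟨fun h => ?_, fun h => by rw [h.1, h.2]⟩
  have hk : k = k' := by
    have h1 := congrArg (· / D) h
    simpa [Nat.mul_comm _ D, Nat.mul_add_div (Nat.zero_lt_of_lt hd), Nat.div_eq_of_lt hd,
      Nat.div_eq_of_lt hd'] using h1
  subst hk
  exact ⟨rfl, by omega⟩

theorem runs_averageSamples {ω : Tape} {P : Params} {σ : State} (hσ : Env P σ) :
    Runs ω averageSamples σ (P.K * (P.D * (P.s * 100 + 100) + 100) + 100) fun τ => Env P τ ∧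
      ∀ k < P.K, ∀ d < P.D, τ.reals 5 (k * P.D + d) =
        (∑ j ∈ range P.s, P.x (σ.ints 9 (k * P.s + j) * P.D + d)) / P.s := by
  set v : ℕ → ℕ → ℝ := fun k d =>
    (∑ j ∈ range P.s, P.x (σ.ints 9 (k * P.s + j) * P.D + d)) / P.s with hv
  refine Runs.weaken (Runs.forTo (B := P.D * (P.s * 100 + 100) + 50) P.K
    (fun i ρ => ∀ k < i, ∀ d < P.D, ρ.reals 5 (k * P.D + d) = v k d)
    hσ (fun ρ h => h.hK) rfl rfl (by simp) fun k hk ρ hE hS hk' hI => ?_) ?_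
  · have h9 : ρ.ints 9 = σ.ints 9 := hS.ints 9 rfl
    refine Runs.mono (Runs.forTo (B := P.s * 100 + 75) P.D
      -- The finished rows together with the first `i` entries of row `k`.
      (fun i ρ => ∀ k' d, d < P.D → (k' < k ∨ k' = k ∧ d < i) →
        ρ.reals 5 (k' * P.D + d) = v k' d)
      hE (fun ρ h => h.hD) rfl rfl ?_ fun d hd ρ1 hE1 hS1 hd' hI1 => ?_) ?_ fun τ _ hτ => ?_
    · intro k' d hd h
      simpa using hI k' (by omega) d hd
    · refine Runs.weaken (Runs.seq_rset (Runs.seq (Runs.forTo (B := 50) P.s (fun i ρ' =>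
        ρ'.reals 8 0 = ∑ j ∈ range i, P.x (σ.ints 9 (k * P.s + j) * P.D + d))
        (hE1.setReal _ _ _ (by decide) (by decide) (by decide)) (fun ρ h => h.hs) rfl rfl
        (by simp [RExpr.eval, IExpr.eval]) fun j hj ρ2 hE2 hS2 hj' hI2 =>
          Runs.weaken (Runs.rset ?_) ?_) fun τ hS2 h2 => Runs.rset ?_)) ?_
      · have e5 : ρ2.ints 5 0 = k := by rw [hS2.ints 5 rfl]; exact (congrFun (hS1.ints 5 rfl) 0).trans hk'
        have e6 : ρ2.ints 6 0 = d := by rw [hS2.ints 6 rfl]; exact hd'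
        have e9 : ρ2.ints 9 = σ.ints 9 := (hS2.ints 9 rfl).trans ((hS1.ints 9 rfl).trans h9)
        simp [RExpr.eval, IExpr.eval, hI2, e5, e6, e9, hj', hE2.hs, hE2.hx, hE2.hD,
          Finset.sum_range_succ]
      · simp [IExpr.steps, RExpr.steps]
      · have e5 : τ.ints 5 0 = k := by rw [hS2.ints 5 rfl]; exact (congrFun (hS1.ints 5 rfl) 0).trans hk'
        have e6 : τ.ints 6 0 = d := by rw [hS2.ints 6 rfl]; exact hd'
        have e5' : τ.reals 5 = ρ1.reals 5 :=
          (hS2.reals 5 rfl).trans (setReal_reals_ne _ _ _ (by decide))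
        intro k' d1 hd1 h
        simp only [IExpr.eval, RExpr.eval, e5, e6, e5', h2.2, h2.1.hD, h2.1.hs, setReal_reals,
          setInt_reals, true_and, mul_add_inj hd1 hd]
        split_ifs with hkd
        · rw [hkd.1, hkd.2]
        · exact hI1 k' d1 hd1 (by omega)
      · simp [IExpr.steps, RExpr.steps]
        omega
    · simp [IExpr.steps]
      nlinarith
    · intro k' hk'' d hd
      rw [setInt_reals]
      exact hτ.2 k' d hd (by omega)
  · simp [IExpr.steps]
    nlinarith

/-- Coordinate `i % D` of mean `i / D` in trial `t`. -/
def trialMeans (P : Params) (ω : Tape) (t i : ℕ) : ℝ :=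
  (∑ j ∈ range P.s,
    P.x (pickIndex P (ω (t * (P.K * P.s) + (i / P.D * P.s + j))) * P.D + i % P.D)) / P.s

/-- Copy the means of the current trial to the output. -/
def copyMeans : Cmd :=
  forTo 3 (.mul numClusters dimension) (.rset 3 (ivar 3) (.load 5 (ivar 3)))

theorem runs_copyMeans {ω : Tape} {P : Params} {σ : State} (hσ : Env P σ) :
    Runs ω copyMeans σ (P.K * P.D * 100 + 100) fun τ => Env P τ ∧
      ∀ i < P.K * P.D, τ.reals 3 i = σ.reals 5 i := by
  refine Runs.weaken (Runs.forTo (B := 50) (P.K * P.D)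
    (fun i ρ => ∀ j < i, ρ.reals 3 j = σ.reals 5 j)
    hσ (fun ρ h => by simp [IExpr.eval, h.hK, h.hD]) rfl rfl (by simp)
    fun i hi ρ hE hS hi' hI => Runs.weaken (Runs.rset fun j hj => ?_) ?_) ?_
  · have h5 : ρ.reals 5 = σ.reals 5 := hS.reals 5 rfl
    by_cases hji : j = i
    · simp [IExpr.eval, RExpr.eval, hi', h5, hji]
    · simp [IExpr.eval, hi', hji, hI j (by omega)]
  · simp [IExpr.steps, RExpr.steps]
  · simp [IExpr.steps]
    nlinarith

/-- One trial: draw means, and keep them if they are better than the best ones so far. -/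
def trial : Cmd :=
  .seq drawIndices (.seq averageSamples (.seq (evalMeans 5)
    (.cond (.rle (rvar 10) (rvar 9)) .skip
      (.seq copyMeans (.rset 10 (.const 0) (rvar 9))))))

/-- A bound for the number of steps of a trial. -/
def trialSteps (P : Params) : ℕ :=
  (P.K * P.s * (P.N * 100 + 200) + 100) + (P.K * (P.D * (P.s * 100 + 100) + 100) + 100) +
    (P.N * (P.K * (400 + P.D * 100) + 450) + 100) + (P.K * P.D * 100 + 200)

/-- Every trial consumes exactly `K * s` draws, whatever their outcome, so trial `t` reads a fixed
block of the tape. This makes the trials independent. -/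
theorem runs_trial {ω : Tape} {P : Params} {σ : State} (hσ : Env P σ) {t : ℕ}
    (hp : σ.pos = t * (P.K * P.s)) (hb : σ.reals 10 0 = optCost P (σ.reals 3)) :
    Runs ω trial σ (trialSteps P) fun τ => Env P τ ∧ τ.pos = (t + 1) * (P.K * P.s) ∧
      τ.reals 10 0 = optCost P (τ.reals 3) ∧ τ.reals 10 0 ≤ σ.reals 10 0 ∧
      τ.reals 10 0 ≤ optCost P (trialMeans P ω t) := by
  refine Runs.weaken (Runs.seq (runs_drawIndices hσ) fun ρ1 hS1 h1 =>
    Runs.seq (runs_averageSamples h1.1) fun ρ2 hS2 h2 =>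
    Runs.seq (runs_evalMeans h2.1 (Or.inr rfl)) fun ρ3 hS3 h3 =>
    Runs.cond (fun hc => Runs.skip ?_)
      (fun hc => Runs.seq (runs_copyMeans h3.1) fun ρ4 hS4 h4 => Runs.rset ?_)) ?_
  all_goals try
    have e10 : ρ3.reals 10 = σ.reals 10 := by
      rw [hS3.reals 10 rfl, hS2.reals 10 rfl, hS1.reals 10 rfl]
    have e3 : ρ3.reals 3 = σ.reals 3 := by
      rw [hS3.reals 3 rfl, hS2.reals 3 rfl, hS1.reals 3 rfl]
    have e5 : ρ3.reals 5 = ρ2.reals 5 := hS3.reals 5 rfl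
    have epos : ρ3.pos = (t + 1) * (P.K * P.s) := by
      rw [hS3.pos rfl, hS2.pos rfl, h1.2.1, hp]; ring
    have hM : ∀ k < P.K, ∀ d < P.D,
        ρ2.reals 5 (k * P.D + d) = trialMeans P ω t (k * P.D + d) := by
      intro k hk d hd
      have hD : 0 < P.D := by omega
      rw [h2.2 k hk d hd, trialMeans, Nat.mul_comm k P.D, Nat.mul_add_div hD, Nat.div_eq_of_lt hd,
        Nat.mul_add_mod, Nat.mod_eq_of_lt hd, add_zero]
      congr 1
      refine Finset.sum_congr rfl fun j hj => ?_
      have hj := Finset.mem_range.1 hj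
      rw [h1.2.2 _ (by nlinarith [Nat.mul_le_mul_right P.s hk]), hp]
    have hcost : ρ3.reals 9 0 = optCost P (trialMeans P ω t) := by
      rw [h3.2.1, optCost_congr hM]
  · simp only [BExpr.Holds, RExpr.eval, IExpr.eval] at hc
    refine ⟨h3.1, epos, ?_, ?_, ?_⟩
    · rw [e10, e3, hb]
    · rw [e10]
    · rw [← hcost]; exact hc
  · simp only [BExpr.Holds, RExpr.eval, IExpr.eval, not_le] at hc
    have e9 : ρ4.reals 9 = ρ3.reals 9 := hS4.reals 9 rfl
    simp only [RExpr.eval, IExpr.eval, e9]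
    refine ⟨h4.1.setReal _ _ _ (by decide) (by decide) (by decide), ?_, ?_, ?_, ?_⟩
    · rw [setReal_pos, hS4.pos rfl, epos]
    · rw [setReal_reals_ne (a := 10) (b := 3) _ _ _ (by decide), setReal_reals, if_pos ⟨rfl, rfl⟩, hcost]
      refine optCost_congr fun k hk d hd => ?_
      rw [h4.2 _ (by nlinarith [Nat.mul_le_mul_right P.D hk]), e5, hM k hk d hd]
    · rw [setReal_reals, if_pos ⟨rfl, rfl⟩, ← e10]
      exact hc.le
    · rw [setReal_reals, if_pos ⟨rfl, rfl⟩, hcost]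
  · simp [IExpr.steps, RExpr.steps, BExpr.steps, trialSteps]
    omega

/-- Store in cell `(1, c)` the least number whose product with the real variable `13` is at
least `2`. -/
def leastMultiple (c : ℕ) : Cmd :=
  .seq (.iset 1 (.const c) (.const 0))
    (.loop (.not (.rle (.ofInt (.const 2)) (.mul (.ofInt (.load 1 (.const c))) (rvar 13))))
      (.iset 1 (.const c) (.add (.load 1 (.const c)) (.const 1))))

/-- Reals cannot be rounded, so `⌈2 / y⌉₊` is found by counting up. This is affordable, since `s`
and `T` are factors of the running time anyway. -/
theorem runs_leastMultiple {ω : Tape} {σ : State} (c : ℕ) {y : ℝ} (hy : 0 < y)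
    (hσ : σ.reals 13 0 = y) :
    Runs ω (leastMultiple c) σ (⌈2 / y⌉₊ * 100 + 100) fun τ => τ.ints 1 c = ⌈2 / y⌉₊ ∧
      ∀ c' ≠ c, τ.ints 1 c' = σ.ints 1 c' := by
  refine Runs.weaken (Runs.seq_iset (Runs.loop (B := 50) ⌈2 / y⌉₊ (fun i ρ => ρ.ints 1 c = i ∧
    ∀ c' ≠ c, ρ.ints 1 c' = σ.ints 1 c') ?_ ?_ ?_)) ?_
  · refine ⟨by simp [IExpr.eval], fun c' hc => by simp [IExpr.eval, hc]⟩
  · rintro i hi ρ hS ⟨hI, hI'⟩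
    have e : ρ.reals 13 0 = y := by rw [hS.reals 13 rfl]; exact hσ
    refine ⟨?_, Runs.weaken (Runs.iset ⟨?_, fun c' hc => ?_⟩) ?_⟩
    · simp only [BExpr.Holds, RExpr.eval, IExpr.eval, e, hI, not_le]
      have := Nat.lt_ceil.1 hi
      rw [lt_div_iff₀ hy] at this
      exact_mod_cast this
    · simp [IExpr.eval, hI]
    · simp [IExpr.eval, hc, hI' c' hc]
    · simp [IExpr.steps]
  · rintro ρ hS ⟨hI, -⟩
    have e : ρ.reals 13 0 = y := by rw [hS.reals 13 rfl]; exact hσ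
    simp only [BExpr.Holds, RExpr.eval, IExpr.eval, e, hI, not_not]
    have := Nat.le_ceil (2 / y)
    rw [div_le_iff₀ hy] at this
    exact_mod_cast this
  · simp [IExpr.steps, RExpr.steps, BExpr.steps]
    omega

/-- Compute the total weight. -/
def totalWeight : Cmd :=
  .seq (.rset 8 (.const 0) (.ofInt (.const 0)))
    (.seq (forTo 4 numPoints (.rset 8 (.const 0) (.add (rvar 8) (.load 1 (ivar 4)))))
      (.rset 6 (.const 0) (rvar 8)))

theorem runs_totalWeight {ω : Tape} {P : Params} {σ : State} (hσ : Env P σ) :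
    Runs ω totalWeight σ (P.N * 100 + 100) fun τ =>
      Env { P with W := ∑ n ∈ range P.N, P.w n } τ := by
  refine Runs.weaken (Runs.seq_rset (Runs.seq (Runs.forTo (B := 50) P.N (fun i ρ =>
    ρ.reals 8 0 = ∑ n ∈ range i, P.w n) (hσ.setReal _ _ _ (by decide) (by decide) (by decide))
    (fun ρ h => h.hN) rfl rfl (by simp [RExpr.eval, IExpr.eval])
    fun n hn ρ hE hS hn' hI => Runs.weaken (Runs.rset ?_) ?_)
    fun ρ hS h => Runs.rset ?_)) ?_
  · simp [RExpr.eval, IExpr.eval, hI, hn', hE.hw, Finset.sum_range_succ]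
  · simp [IExpr.steps, RExpr.steps]
  · obtain ⟨⟨a1, a2, a3, a4, a5, a6, a7, a8, a9⟩, h⟩ := h
    refine ⟨a1, a2, a3, a4, a5, a6, ?_, ?_, ?_⟩
    · rw [setReal_reals_ne _ _ _ (by decide), a7]
    · rw [setReal_reals_ne _ _ _ (by decide), a8]
    · simp [IExpr.eval, RExpr.eval, h]
  · simp [IExpr.steps, RExpr.steps]
    omega

/-- The approximation algorithm. -/
def fuzzyKMeans : Cmd :=
  .seq (.rset 13 (.const 0) (.load 0 (.const 0))) (.seq (leastMultiple 0)
    (.seq (.rset 13 (.const 0) (.pow (.load 0 (.const 1)) (.mul numClusters numSamples)))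
    -- The initial contents of array `3` (zeros) serve as the first candidate. The closing
    -- `evalMeans 3` is needed because the trials overwrite the memberships in array `4`.
    (.seq (leastMultiple 1) (.seq totalWeight (.seq (evalMeans 3)
      (.seq (.rset 10 (.const 0) (rvar 9)) (.seq (forTo 2 numTrials trial) (evalMeans 3))))))))

/-- The parameters with which the algorithm works. -/
def inputParams (N D K m : ℕ) (w x : ℕ → ℝ) (ε α : ℝ) : Params where
  N := N
  D := D
  K := K
  m := m
  s := ⌈2 / ε⌉₊
  T := ⌈2 / α ^ (K * ⌈2 / ε⌉₊)⌉₊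
  w := w
  x := x
  W := ∑ n ∈ range N, w n

/-- A bound for the number of steps of the algorithm. -/
def totalSteps (P : Params) : ℕ :=
  P.s * 100 + P.T * 100 + P.N * 100 + 2 * (P.N * (P.K * (400 + P.D * 100) + 450) + 100) +
    P.T * (trialSteps P + 100) + 1000

theorem runs_fuzzyKMeans (ω : Tape) {σ : State} {N D K m : ℕ} {w x : ℕ → ℝ} {ε α : ℝ}
    (hε : 0 < ε) (hα : 0 < α) (hN : σ.ints 0 0 = N) (hD : σ.ints 0 1 = D) (hK : σ.ints 0 2 = K)
    (hm : σ.ints 0 3 = m) (h0 : σ.reals 0 0 = ε) (h1 : σ.reals 0 1 = α) (hw : σ.reals 1 = w)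
    (hx : σ.reals 2 = x) (hp : σ.pos = 0) {P : Params} (hP : P = inputParams N D K m w x ε α) :
    Runs ω fuzzyKMeans σ (totalSteps P) fun τ =>
      (∀ n < N, ∀ k < K, τ.reals 4 (n * K + k) =
        FuzzyKMeans.optMembership m K (sqDist P (τ.reals 3) n) k) ∧
      ∀ t < P.T, optCost P (τ.reals 3) ≤ optCost P (trialMeans P ω t) := by
  have hPN : P.N = N := by rw [hP]; rfl
  have hPK : P.K = K := by rw [hP]; rfl
  have hPm : P.m = m := by rw [hP]; rfl
  have hPs : P.s = ⌈2 / ε⌉₊ := by rw [hP]; rfl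
  have hPT : P.T = ⌈2 / α ^ (K * P.s)⌉₊ := by rw [hP]; rfl
  refine Runs.weaken (Runs.seq_rset (Runs.seq (runs_leastMultiple 0 hε ?_) fun ρ1 hS1 h1' =>
    Runs.seq_rset (Runs.seq (runs_leastMultiple 1 (pow_pos hα (K * P.s)) ?_) fun ρ2 hS2 h2 =>
    -- Until the total weight has been computed, the current content of its cell stands in for `W`.
    Runs.seq (runs_totalWeight (P := { P with W := σ.reals 6 0 }) ?_) fun ρ3 hS3 h3 =>
    Runs.seq (runs_evalMeans (P := P) ?_ (Or.inl rfl)) fun ρ4 hS4 h4 => Runs.seq_rset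
    (Runs.seq (Runs.forTo (B := trialSteps P) P.T (fun i ρ => ρ.pos = i * (P.K * P.s) ∧
      ρ.reals 10 0 = optCost P (ρ.reals 3) ∧
      ∀ t < i, ρ.reals 10 0 ≤ optCost P (trialMeans P ω t))
      (h4.1.setReal _ _ _ (by decide) (by decide) (by decide)) (fun ρ h => h.hT) rfl rfl ?_
      fun t ht ρ hE hS ht' hI => ?_) fun ρ5 hS5 h5 =>
    Runs.mono (runs_evalMeans h5.1 (Or.inl rfl)) le_rfl fun τ hS6 h6 => ?_)))) ?_
  · simp [IExpr.eval, RExpr.eval, h0]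
  · have e0 : ρ1.reals 0 1 = α := by
      rw [hS1.reals 0 rfl, setReal_reals_ne _ _ _ (by decide), h1]
    have e0' : ρ1.ints 0 2 = K := by rw [hS1.ints 0 rfl]; exact hK
    simp [IExpr.eval, RExpr.eval, e0, e0', h1'.1, hPs]
  · have i0 : ρ2.ints 0 = σ.ints 0 := (hS2.ints 0 rfl).trans (hS1.ints 0 rfl)
    have r1 : ∀ a, a ≠ 13 → ρ2.reals a = σ.reals a := by
      intro a ha
      rw [hS2.reals a rfl, setReal_reals_ne _ _ _ ha, hS1.reals a rfl, setReal_reals_ne _ _ _ ha]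
    refine ⟨?_, ?_, ?_, ?_, ?_, ?_, ?_, ?_, ?_⟩
    · rw [i0, hN, hP]; rfl
    · rw [i0, hD, hP]; rfl
    · rw [i0, hK, hP]; rfl
    · rw [i0, hm, hP]; rfl
    · rw [h2.2 0 (by decide)]; exact h1'.1.trans hPs.symm
    · rw [h2.1]; exact hPT.symm
    · rw [r1 1 (by decide), hw, hP]; rfl
    · rw [r1 2 (by decide), hx, hP]; rfl
    · rw [r1 6 (by decide)]
  · have : P = { P with W := ∑ n ∈ range P.N, P.w n } := by rw [hP]; rfl
    rw [this]
    exact h3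
  · refine ⟨?_, ?_, by simp⟩
    · rw [setInt_pos, setReal_pos, hS4.pos rfl, hS3.pos rfl, hS2.pos rfl, setReal_pos,
        hS1.pos rfl, setReal_pos, hp, zero_mul]
    · rw [setInt_reals, setReal_reals_ne (a := 10) (b := 3) _ _ _ (by decide), hS4.reals 3 rfl]
      simp [IExpr.eval, RExpr.eval, h4.2.1]
  · refine Runs.mono (runs_trial hE hI.1 hI.2.1) le_rfl fun τ _ hτ => ?_
    refine ⟨hτ.2.1, hτ.2.2.1, fun t' ht' => ?_⟩
    rcases Nat.lt_succ_iff_lt_or_eq.1 ht' with hlt | rfl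
    · exact hτ.2.2.2.1.trans (hI.2.2 t' hlt)
    · exact hτ.2.2.2.2
  · have e3 : τ.reals 3 = ρ5.reals 3 := hS6.reals 3 rfl
    rw [e3]
    refine ⟨fun n hn k hk => ?_, fun t ht => ?_⟩
    · rw [← hPK, ← hPm]
      exact h6.2.2 n (hPN ▸ hn) k (hPK ▸ hk)
    · rw [← h5.2.2.1]
      exact h5.2.2.2 t ht
  · simp [IExpr.steps, RExpr.steps, totalSteps, ← hPs, ← hPT]
    rw [Nat.mul_add P.T, Nat.mul_add P.T]
    omega

end RealRAM

namespace FuzzyKMeans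

/-! Sampling from finite product distributions. -/

section Product

variable {ι : Type*} [Fintype ι] [DecidableEq ι] {N : ℕ} {q : ι → Fin N → ℝ}

/-- Expectations of products factor under a product law. The moments below follow by letting `u` be
`1` off one or two coordinates. -/
theorem sum_prod_mul_prod (q u : ι → Fin N → ℝ) :
    ∑ f : ι → Fin N, (∏ i, q i (f i)) * ∏ i, u i (f i) = ∏ i, ∑ n, q i n * u i n := by
  rw [Finset.prod_univ_sum, Fintype.piFinset_univ]
  simp only [Finset.prod_mul_distrib]

theorem sum_prod_eq_one (hq : ∀ i, ∑ n, q i n = 1) :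
    ∑ f : ι → Fin N, ∏ i, q i (f i) = 1 := by
  simpa [hq] using sum_prod_mul_prod q fun _ _ => 1

theorem sum_prod_mul_apply (hq : ∀ i, ∑ n, q i n = 1) (i : ι) (g : Fin N → ℝ) :
    ∑ f : ι → Fin N, (∏ l, q l (f l)) * g (f i) = ∑ n, q i n * g n := by
  have h := sum_prod_mul_prod q fun l n => if l = i then g n else 1
  simp only [Finset.prod_ite_eq', Finset.mem_univ, if_true] at h
  rw [h, Finset.prod_eq_single i]
  · simp
  · intro l _ hl
    simp [hl, hq]
  · simp

theorem sum_prod_mul_apply_mul_apply (hq : ∀ i, ∑ n, q i n = 1) {i j : ι} (hij : i ≠ j)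
    (g h : Fin N → ℝ) :
    ∑ f : ι → Fin N, (∏ l, q l (f l)) * (g (f i) * h (f j)) =
      (∑ n, q i n * g n) * ∑ n, q j n * h n := by
  have H := sum_prod_mul_prod q fun l n => (if l = i then g n else 1) * if l = j then h n else 1
  simp only [Finset.prod_mul_distrib, Finset.prod_ite_eq', Finset.mem_univ, if_true] at H
  rw [H, ← Finset.mul_prod_erase _ _ (Finset.mem_univ i),
    ← Finset.mul_prod_erase _ _ (Finset.mem_erase.2 ⟨hij.symm, Finset.mem_univ j⟩),
    Finset.prod_eq_one]
  · simp [hij, hij.symm]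
  · intro l hl
    simp only [Finset.mem_erase] at hl
    simp [hl.1, hl.2.1, hq]

/-- The second moment of a sum of independent centered variables. -/
theorem sum_prod_mul_sum_sq (hq : ∀ i, ∑ n, q i n = 1) {κ : Type*} [Fintype κ] {e : κ → ι}
    (he : Function.Injective e) (y : κ → Fin N → ℝ) (hy : ∀ j, ∑ n, q (e j) n * y j n = 0) :
    ∑ f : ι → Fin N, (∏ l, q l (f l)) * (∑ j, y j (f (e j))) ^ 2 =
      ∑ j, ∑ n, q (e j) n * y j n ^ 2 := by
  classical
  simp only [sq, Finset.sum_mul_sum]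
  simp only [Finset.mul_sum]
  rw [Finset.sum_comm]
  refine Finset.sum_congr rfl fun j _ => ?_
  rw [Finset.sum_comm, Finset.sum_eq_single j]
  · exact sum_prod_mul_apply hq (e j) fun n => y j n * y j n
  · intro j' _ hj
    -- Mixed terms factor by independence and vanish by centering.
    rw [sum_prod_mul_apply_mul_apply hq (he.ne hj.symm), hy, zero_mul]
  · simp

end Product

/-! ### Sample means and Markov's inequality -/

section Markov

variable {K s N D : ℕ}

/-- The mean of the points that were sampled for cluster `k`. -/
def sampleMean (x : Fin N → EuclideanSpace ℝ (Fin D)) (f : Fin K × Fin s → Fin N) (k : Fin K) :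
    EuclideanSpace ℝ (Fin D) := (s : ℝ)⁻¹ • ∑ j, x (f (k, j))

/-- The variance of an average of `s` independent draws is `1 / s` of the variance of one draw,
applied in each coordinate. -/
theorem sum_prod_mul_norm_sampleMean_sub_sq (hs : 1 ≤ s) (x : Fin N → EuclideanSpace ℝ (Fin D))
    {q : Fin K → Fin N → ℝ} (hq : ∀ k, ∑ n, q k n = 1) {k : Fin K}
    {c : EuclideanSpace ℝ (Fin D)} (hc : ∑ n, q k n • (x n - c) = 0) :
    ∑ f : Fin K × Fin s → Fin N, (∏ i, q i.1 (f i)) * ‖sampleMean x f k - c‖ ^ 2 =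
      (s : ℝ)⁻¹ * ∑ n, q k n * ‖x n - c‖ ^ 2 := by
  have hs0 : (s : ℝ) ≠ 0 := by positivity
  have hcd : ∀ d, ∑ n, q k n * (x n d - c d) = 0 := by
    intro d
    have := congrArg (fun v : EuclideanSpace ℝ (Fin D) => v d) hc
    simpa using this
  have h1 : ∀ (f : Fin K × Fin s → Fin N) d,
      (sampleMean x f k - c) d = (s : ℝ)⁻¹ * ∑ j, (x (f (k, j)) d - c d) := by
    intro f d
    simp [sampleMean, Finset.sum_sub_distrib]
    field_simp
  have h2 : ∀ d, ∑ f : Fin K × Fin s → Fin N, (∏ i, q i.1 (f i)) *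
      (∑ j, (x (f (k, j)) d - c d)) ^ 2 = s * ∑ n, q k n * (x n d - c d) ^ 2 := by
    intro d
    rw [sum_prod_mul_sum_sq (q := fun i : Fin K × Fin s => q i.1) (fun i => hq i.1)
      (e := fun j : Fin s => (k, j)) (fun a b h => (Prod.mk.inj h).2)
      (fun _ n => x n d - c d) fun _ => hcd d]
    simp
  have h3 : ∀ f : Fin K × Fin s → Fin N, (∏ i, q i.1 (f i)) * ‖sampleMean x f k - c‖ ^ 2 =
      ∑ d, ((s : ℝ)⁻¹) ^ 2 * ((∏ i, q i.1 (f i)) * (∑ j, (x (f (k, j)) d - c d)) ^ 2) := by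
    intro f
    rw [EuclideanSpace.real_norm_sq_eq, Finset.mul_sum]
    exact Finset.sum_congr rfl fun d _ => by rw [h1, mul_pow]; ring
  have h4 : ∑ n, q k n * ‖x n - c‖ ^ 2 = ∑ d, ∑ n, q k n * (x n d - c d) ^ 2 := by
    rw [Finset.sum_comm]
    refine Finset.sum_congr rfl fun n _ => ?_
    rw [EuclideanSpace.real_norm_sq_eq, Finset.mul_sum]
    rfl
  rw [Finset.sum_congr rfl fun f _ => h3 f, Finset.sum_comm, h4, Finset.mul_sum]
  refine Finset.sum_congr rfl fun d _ => ?_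
  rw [← Finset.mul_sum, h2 d]
  field_simp

/-- Samples from the weights yield good means of the subdistributions `a k` with a probability that
is bounded from below. -/
theorem le_sum_prod_good {x : Fin N → EuclideanSpace ℝ (Fin D)} {w : Fin N → ℝ}
    {a : Fin K → Fin N → ℝ} {α ε : ℝ} (hα : 0 < α) (hε : 0 < ε) (hs : 2 ≤ s * ε)
    (hW : 0 < ∑ n, w n) (ha0 : ∀ k n, 0 ≤ a k n) (haw : ∀ k n, a k n ≤ w n)
    (hA : ∀ k, α * ∑ n, w n ≤ ∑ n, a k n) (G : Finset (Fin K))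
    (good : Set (Fin K × Fin s → Fin N))
    (hgood : ∀ f, ∑ k ∈ G, (∑ n, a k n) * ‖sampleMean x f k - centroid (a k) x‖ ^ 2 ≤
      ε * ∑ k ∈ G, ∑ n, a k n * ‖x n - centroid (a k) x‖ ^ 2 → f ∈ good) [DecidablePred (· ∈ good)] :
    α ^ (K * s) / 2 ≤ ∑ f with f ∈ good, ∏ i, w (f i) / ∑ n, w n := by
  set W := ∑ n, w n with hWdef
  set q : Fin K → Fin N → ℝ := fun k n => a k n / ∑ n, a k n with hq
  set Z : (Fin K × Fin s → Fin N) → ℝ := fun f =>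
    ∑ k ∈ G, (∑ n, a k n) * ‖sampleMean x f k - centroid (a k) x‖ ^ 2 with hZ
  set C : ℝ := ∑ k ∈ G, ∑ n, a k n * ‖x n - centroid (a k) x‖ ^ 2 with hC
  set Q : (Fin K × Fin s → Fin N) → ℝ := fun f => ∏ i, q i.1 (f i) with hQ
  have hs1 : 1 ≤ s := by
    rcases Nat.eq_zero_or_pos s with rfl | h
    · norm_num at hs
    · exact h
  have hs0 : (0 : ℝ) < s := by exact_mod_cast hs1
  have hApos : ∀ k, 0 < ∑ n, a k n := fun k => (mul_pos hα hW).trans_le (hA k)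
  have hqnn : ∀ k n, 0 ≤ q k n := fun k n => div_nonneg (ha0 k n) (hApos k).le
  have hq1 : ∀ k, ∑ n, q k n = 1 := fun k => by
    simp only [hq, ← Finset.sum_div]
    exact div_self (hApos k).ne'
  have hQnn : ∀ f, 0 ≤ Q f := fun f => Finset.prod_nonneg fun i _ => hqnn _ _
  have hZnn : ∀ f, 0 ≤ Z f := fun f => Finset.sum_nonneg fun k _ =>
    mul_nonneg (hApos k).le (sq_nonneg _)
  have hCnn : 0 ≤ C := Finset.sum_nonneg fun k _ => Finset.sum_nonneg fun n _ =>
    mul_nonneg (ha0 k n) (sq_nonneg _)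
  have hQ1 : ∑ f, Q f = 1 :=
    sum_prod_eq_one (q := fun i : Fin K × Fin s => q i.1) fun i => hq1 i.1
  have hEZ : ∑ f, Q f * Z f = (s : ℝ)⁻¹ * C := by
    simp only [hZ, hC, Finset.mul_sum]
    rw [Finset.sum_comm]
    refine Finset.sum_congr rfl fun k _ => ?_
    have hc : ∑ n, q k n • (x n - centroid (a k) x) = 0 := by
      have := sum_smul_sub_centroid (hApos k).ne' x
      simp only [hq, div_eq_inv_mul, mul_smul]
      rw [← Finset.smul_sum, this, smul_zero]
    have h := sum_prod_mul_norm_sampleMean_sub_sq hs1 x hq1 hc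
    have h' := congrArg (fun v => (∑ n, a k n) * v) h
    simp only [Finset.mul_sum] at h'
    rw [Finset.sum_congr rfl fun f _ => by rw [mul_left_comm], h']
    refine Finset.sum_congr rfl fun n _ => ?_
    have := (hApos k).ne'
    simp only [hq]
    field_simp
  have hbad : ∑ f with f ∉ good, Q f ≤ 1 / 2 := by
    have h1 : ∀ f, f ∉ good → ε * C < Z f := fun f hf => by
      by_contra h
      exact hf (hgood f (not_lt.1 h))
    -- Markov's inequality divides by `C`. If `C = 0`, then `Z` has mean zero, so samples with `0 <
    -- Z f` have probability zero.
    rcases hCnn.eq_or_lt with hC0 | hC0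
    · rw [← hC0, mul_zero] at hEZ
      have h2 := (Finset.sum_eq_zero_iff_of_nonneg fun f _ => mul_nonneg (hQnn f) (hZnn f)).1 hEZ
      rw [Finset.sum_eq_zero]
      · norm_num
      · intro f hf
        have h3 := h1 f (Finset.mem_filter.1 hf).2
        rw [← hC0, mul_zero] at h3
        exact (mul_eq_zero.1 (h2 f (Finset.mem_univ f))).resolve_right h3.ne'
    · have h2 : (∑ f with f ∉ good, Q f) * (ε * C) ≤ (s : ℝ)⁻¹ * C := by
        rw [← hEZ, Finset.sum_mul]
        refine (Finset.sum_le_sum fun f hf => ?_).trans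
          (Finset.sum_le_sum_of_subset_of_nonneg (Finset.filter_subset _ _) fun f _ _ =>
            mul_nonneg (hQnn f) (hZnn f))
        exact mul_le_mul_of_nonneg_left (h1 f (Finset.mem_filter.1 hf).2).le (hQnn f)
      rw [← mul_assoc] at h2
      have h3 := le_of_mul_le_mul_right h2 hC0
      have h4 : (s : ℝ)⁻¹ ≤ 1 / 2 * ε := by
        rw [inv_le_iff_one_le_mul₀ hs0]
        linarith
      exact le_of_mul_le_mul_right (h3.trans h4) hε
  have hQgood : 1 / 2 ≤ ∑ f with f ∈ good, Q f := by
    have := Finset.sum_filter_add_sum_filter_not Finset.univ (· ∈ good) Q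
    linarith
  -- Change of law: each of the `K * s` factors loses at most `α`, because `a k n ≤ w n` and `a k`
  -- has mass at least `α * W`.
  have hle : ∀ f : Fin K × Fin s → Fin N, α ^ (K * s) * Q f ≤ ∏ i, w (f i) / W := by
    intro f
    have : α ^ (K * s) = ∏ _i : Fin K × Fin s, α := by simp
    rw [this, hQ, ← Finset.prod_mul_distrib]
    refine Finset.prod_le_prod (fun i _ => mul_nonneg hα.le (hqnn _ _)) fun i _ => ?_
    simp only [hq]
    rw [le_div_iff₀ hW, mul_comm α, mul_assoc, div_mul_eq_mul_div, div_le_iff₀ (hApos _)]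
    exact mul_le_mul (haw _ _) (hA _) (mul_pos hα hW).le ((ha0 _ _).trans (haw i.1 _))
  calc α ^ (K * s) / 2 = α ^ (K * s) * (1 / 2) := by ring
    _ ≤ α ^ (K * s) * ∑ f with f ∈ good, Q f := by gcongr
    _ ≤ _ := by
      rw [Finset.mul_sum]
      exact Finset.sum_le_sum fun f _ => hle f

end Markov

/-- A sample is good for the solution `(μ, r)` if its means are almost as cheap. -/
def IsGoodSample {N D L K s : ℕ} (m : ℕ) (x : Fin N → EuclideanSpace ℝ (Fin D)) (w : Fin N → ℝ)
    (ε : ℝ) (μ : Fin L → EuclideanSpace ℝ (Fin D)) (r : Fin N → Fin L → ℝ)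
    (f : Fin K × Fin s → Fin N) : Prop :=
  ∃ r' : Fin N → Fin K → ℝ, IsMembership r' ∧
    cost m x w (sampleMean x f) r' ≤ (1 + ε) * cost m x w μ r

/-- The solution is padded to `K` clusters with zero memberships. By the parallel axis theorem the
cost of the sampled means is the cost at the centroids plus the deviation that `le_sum_prod_good`
controls. -/
theorem le_sum_prod_isGoodSample {N D L K s m : ℕ} (hm : 1 ≤ m)
    {x : Fin N → EuclideanSpace ℝ (Fin D)} {w : Fin N → ℝ} (hw : ∀ n, 0 ≤ w n)
    (hW : 0 < ∑ n, w n) {α ε : ℝ} (hα : 0 < α) (hα1 : α ≤ 1) (hε : 0 < ε) (hs : 2 ≤ s * ε)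
    {μ : Fin L → EuclideanSpace ℝ (Fin D)} {r : Fin N → Fin L → ℝ} (hr : IsMembership r)
    (hb : IsBalanced m w (α * ∑ n, w n) K r)
    [DecidablePred (IsGoodSample (K := K) (s := s) m x w ε μ r)] :
    α ^ (K * s) / 2 ≤
      ∑ f : Fin K × Fin s → Fin N with IsGoodSample m x w ε μ r f, ∏ i, w (f i) / ∑ n, w n := by
  classical
  obtain ⟨hLK, hb⟩ := hb
  set r' : Fin N → Fin K → ℝ := fun n k => if h : (k : ℕ) < L then r n ⟨k, h⟩ else 0 with hr'
  -- A padding cluster gets all of `w`, which meets the mass bound since `α ≤ 1`; it lies outside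
  -- `G` and so does not enter the error.
  set a : Fin K → Fin N → ℝ := fun k n =>
    if h : (k : ℕ) < L then r n ⟨k, h⟩ ^ m * w n else w n with ha
  set G : Finset (Fin K) := Finset.univ.map (Fin.castLEEmb hLK) with hG
  have hsum : ∀ (F : Fin K → ℝ), (∀ k : Fin K, ¬ (k : ℕ) < L → F k = 0) →
      ∑ k, F k = ∑ l : Fin L, F (Fin.castLE hLK l) := by
    intro F hF
    have h1 : ∑ l : Fin L, F (Fin.castLE hLK l) = ∑ k ∈ G, F k := by
      rw [hG, Finset.sum_map]; rfl
    rw [h1]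
    refine (Finset.sum_subset (Finset.subset_univ _) fun k _ hk => hF k fun hlt => hk ?_).symm
    rw [hG, Finset.mem_map]
    exact ⟨⟨k, hlt⟩, Finset.mem_univ _, rfl⟩
  have hrm : IsMembership r' := by
    refine ⟨fun n k => ?_, fun n => ?_⟩
    · simp only [hr']
      split_ifs with h
      · exact hr.1 n _
      · simp
    · rw [hsum _ fun k hk => by simp [hr', hk]]
      simpa [hr'] using hr.2 n
  have hal : ∀ l : Fin L, a (Fin.castLE hLK l) = fun n => r n l ^ m * w n := by
    intro l; funext n; simp [ha]
  have hapos : ∀ l : Fin L, 0 < ∑ n, r n l ^ m * w n := fun l =>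
    (mul_pos hα hW).trans_le (hb l)
  have hann : ∀ (l : Fin L) n, 0 ≤ r n l ^ m * w n := fun l n =>
    mul_nonneg (pow_nonneg (hr.1 n l).1 _) (hw n)
  refine le_sum_prod_good (x := x) (a := a) hα hε hs hW ?_ ?_ ?_ G
    {f | IsGoodSample m x w ε μ r f} ?_
  · intro k n
    simp only [ha]
    split_ifs with h
    · exact hann _ n
    · exact hw n
  · intro k n
    simp only [ha]
    split_ifs with h
    · exact mul_le_of_le_one_left (hw n) (pow_le_one₀ (hr.1 n _).1 (hr.1 n _).2)
    · exact le_rfl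
  · intro k
    simp only [ha]
    split_ifs with h
    · exact hb _
    · exact mul_le_of_le_one_left hW.le hα1
  · intro f hf
    refine ⟨r', hrm, ?_⟩
    simp only [hG, Finset.sum_map, Fin.castLEEmb_apply, hal] at hf
    have h1 : ∑ l : Fin L, ∑ n, r n l ^ m * w n *
        ‖x n - centroid (fun n => r n l ^ m * w n) x‖ ^ 2 ≤ cost m x w μ r := by
      rw [cost_eq_sum_clusters]
      exact Finset.sum_le_sum fun l _ =>
        sum_mul_norm_sub_centroid_le (hann l) (hapos l).ne' x (μ l)
    -- Padding clusters cost nothing, as `0 ^ m = 0` for `1 ≤ m`.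
    rw [cost_eq_sum_clusters, hsum _ fun k hk => by
      simp [hr', hk, Nat.one_le_iff_ne_zero.1 hm]]
    have h2 : ∀ l : Fin L, ∑ n, r' n (Fin.castLE hLK l) ^ m * w n *
        ‖x n - sampleMean x f (Fin.castLE hLK l)‖ ^ 2 =
        ∑ n, r n l ^ m * w n * ‖x n - centroid (fun n => r n l ^ m * w n) x‖ ^ 2 +
        (∑ n, r n l ^ m * w n) * ‖sampleMean x f (Fin.castLE hLK l) -
          centroid (fun n => r n l ^ m * w n) x‖ ^ 2 := by
      intro l
      rw [← sum_mul_norm_sub_sq (hapos l).ne']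
      simp [hr']
    rw [Finset.sum_congr rfl fun l _ => h2 l, Finset.sum_add_distrib, add_mul, one_mul]
    exact add_le_add h1 (hf.trans (mul_le_mul_of_nonneg_left h1 hε.le))

end FuzzyKMeans

namespace RealRAM

open Finset (range)

/-! The law of the samples. -/

instance : IsProbabilityMeasure tapeMeasure := by
  unfold tapeMeasure; infer_instance

/-- The law of finitely many draws. -/
def drawsMeasure (ι : Type*) : Measure (ι → unitInterval) :=
  Measure.infinitePi fun _ : ι => (volume : Measure unitInterval)

instance (ι : Type*) : IsProbabilityMeasure (drawsMeasure ι) := by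
  unfold drawsMeasure; infer_instance

/-- Disjoint blocks of the tape are independent. -/
theorem tapeMeasure_forall_block {T : ℕ} {ι : Type*} {e : Fin T × ι → ℕ}
    (he : Function.Injective e) {B : Set (ι → unitInterval)} (hB : MeasurableSet B) :
    tapeMeasure {ω | ∀ t, (fun i => ω (e (t, i))) ∈ B} = drawsMeasure ι B ^ T := by
  have h1 : tapeMeasure.map (fun ω p => ω (e p)) =
      Measure.infinitePi fun _ : Fin T × ι => (volume : Measure unitInterval) :=
    Measure.map_infinitePi_infinitePi_of_inj he
  -- Currying turns the law of the `T × ι` selected cells into a product of `T` copies of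
  -- `drawsMeasure ι`.
  have h2 := Measure.infinitePi_map_curry
    (fun (_ : Fin T) (_ : ι) => (volume : Measure unitInterval))
  rw [← h1, Measure.map_map (by fun_prop) (by fun_prop)] at h2
  have h3 : MeasurableSet (Set.pi ((Finset.univ : Finset (Fin T)) : Set (Fin T)) fun _ => B) :=
    MeasurableSet.pi (Set.to_countable _) fun _ _ => hB
  have h4 := Measure.infinitePi_pi (fun _ : Fin T => drawsMeasure ι) (s := Finset.univ)
    (t := fun _ => B) fun _ _ => hB
  rw [Finset.prod_const, Finset.card_univ, Fintype.card_fin] at h4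
  rw [← h4]
  change _ = Measure.infinitePi
    (fun _ : Fin T => Measure.infinitePi fun _ : ι => (volume : Measure unitInterval)) _
  rw [← h2, Measure.map_apply (by fun_prop) h3]
  congr 1
  ext ω
  simp only [Set.mem_ofPred_eq, Set.mem_preimage, Set.mem_pi, Finset.mem_coe, Finset.mem_univ,
    forall_true_left]
  rfl

/-- All blocks miss `B` with probability at most `(1 - δ) ^ T ≤ exp (-(T * δ)) ≤ exp (-1) < 1 / 2`.
-/
theorem half_le_tapeMeasure_exists_block {T : ℕ} {ι : Type*} {e : Fin T × ι → ℕ}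
    (he : Function.Injective e) {B : Set (ι → unitInterval)} (hB : MeasurableSet B) {δ : ℝ}
    (hδ : δ ≤ (drawsMeasure ι).real B) (hT : 1 ≤ T * δ) :
    1 / 2 ≤ tapeMeasure.real {ω | ∃ t, (fun i => ω (e (t, i))) ∈ B} := by
  have hmeas : MeasurableSet {ω : Tape | ∃ t, (fun i => ω (e (t, i))) ∈ B} := by
    simp only [Set.ofPred_exists]
    exact MeasurableSet.iUnion fun t => hB.preimage (by fun_prop)
  have h1 : tapeMeasure.real {ω | ∃ t, (fun i => ω (e (t, i))) ∈ B}ᶜ =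
      (1 - (drawsMeasure ι).real B) ^ T := by
    rw [← probReal_compl_eq_one_sub hB, measureReal_def, measureReal_def, ← ENNReal.toReal_pow,
      ← tapeMeasure_forall_block he hB.compl]
    congr 2
    ext ω
    simp
  have h2 : (1 - (drawsMeasure ι).real B) ^ T ≤ Real.exp (-1) := by
    have h3 : 0 ≤ 1 - (drawsMeasure ι).real B := sub_nonneg.2 measureReal_le_one
    calc (1 - (drawsMeasure ι).real B) ^ T ≤ Real.exp (-δ) ^ T := by
          gcongr
          have := Real.one_sub_le_exp_neg δ
          linarith
      _ = Real.exp (-(T * δ)) := by rw [← Real.exp_nat_mul]; ring_nf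
      _ ≤ Real.exp (-1) := by gcongr
  have h4 := probReal_compl_eq_one_sub (μ := tapeMeasure) hmeas
  have h5 := Real.exp_neg_one_lt_d9
  linarith

theorem pickIndex_lt (P : Params) (hN : 1 ≤ P.N) (u : ℝ) : pickIndex P u < P.N := by
  have : pickIndex P u ≤ P.N - 1 := by
    rw [pickIndex, Finset.sum_boole]
    simpa using Finset.card_filter_le (range (P.N - 1)) _
  omega

theorem measurable_pickIndex (P : Params) :
    Measurable fun u : unitInterval => pickIndex P u := by
  unfold pickIndex
  refine Finset.measurable_sum _ fun n _ => Measurable.ite ?_ measurable_const measurable_const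
  exact measurableSet_lt measurable_const (measurable_subtype_coe.mul_const _)

theorem pickIndex_eq {P : Params} (hw : ∀ n < P.N, 0 ≤ P.w n) {n : ℕ} (hn : n < P.N) {u : ℝ}
    (h1 : ∑ i ∈ range n, P.w i < u * P.W) (h2 : u * P.W ≤ ∑ i ∈ range (n + 1), P.w i) :
    pickIndex P u = n := by
  have hmono : ∀ i j, i ≤ j → j ≤ P.N → ∑ l ∈ range i, P.w l ≤ ∑ l ∈ range j, P.w l := by
    intro i j hij hj
    refine Finset.sum_le_sum_of_subset_of_nonneg (Finset.range_mono hij) fun l hl _ => hw l ?_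
    have := Finset.mem_range.1 hl
    omega
  -- The partial sums increase, so those counted are exactly the first `n`.
  have h : ∀ i ∈ range (P.N - 1), (∑ l ∈ range (i + 1), P.w l < u * P.W ↔ i < n) := by
    intro i hi
    have hi := Finset.mem_range.1 hi
    refine ⟨fun h => ?_, fun h => (hmono _ _ h hn.le).trans_lt h1⟩
    by_contra hin
    exact absurd (h2.trans (hmono (n + 1) (i + 1) (by omega) (by omega))) (not_le.2 h)
  rw [pickIndex, Finset.sum_boole, Finset.filter_congr h]
  have : (range (P.N - 1)).filter (· < n) = range n := by
    ext i
    simp only [Finset.mem_filter, Finset.mem_range]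
    omega
  simp [this]

/-- The numbers that select `n` contain the interval between two consecutive partial sums divided by
`W`. A lower bound is enough for the success probability. -/
theorem le_volume_pickIndex_eq {P : Params} (hw : ∀ n < P.N, 0 ≤ P.w n) (hW : 0 < P.W)
    (hsum : P.W = ∑ n ∈ range P.N, P.w n) {n : ℕ} (hn : n < P.N) :
    P.w n / P.W ≤ (volume : Measure unitInterval).real {u | pickIndex P u = n} := by
  have hnn : ∀ i ≤ P.N, 0 ≤ ∑ l ∈ range i, P.w l := fun i hi =>
    Finset.sum_nonneg fun l hl => hw l (by have := Finset.mem_range.1 hl; omega)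
  have hle : ∀ i ≤ P.N, ∑ l ∈ range i, P.w l ≤ P.W := fun i hi => by
    rw [hsum]
    exact Finset.sum_le_sum_of_subset_of_nonneg (Finset.range_mono hi) fun l hl _ =>
      hw l (Finset.mem_range.1 hl)
  set c : ∀ i ≤ P.N, unitInterval := fun i hi =>
    ⟨(∑ l ∈ range i, P.w l) / P.W, div_nonneg (hnn i hi) hW.le,
      (div_le_one hW).2 (hle i hi)⟩ with hc
  have hsub : Set.Ioc (c n hn.le) (c (n + 1) hn) ⊆ {u : unitInterval | pickIndex P u = n} := by
    rintro u ⟨h1, h2⟩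
    have h1 : (∑ l ∈ range n, P.w l) / P.W < u := h1
    have h2 : (u : ℝ) ≤ (∑ l ∈ range (n + 1), P.w l) / P.W := h2
    exact pickIndex_eq hw hn ((div_lt_iff₀ hW).1 h1) ((le_div_iff₀ hW).1 h2)
  refine le_trans (le_of_eq ?_) (measureReal_mono hsub)
  rw [measureReal_def, unitInterval.volume_Ioc, ENNReal.toReal_ofReal]
  · simp only [hc, Finset.sum_range_succ]
    ring
  · simp only [hc, Finset.sum_range_succ, add_div, add_sub_cancel_left]
    exact div_nonneg (hw n hn) hW.le

/-- The index that the number `u` selects, as an element of `Fin`. -/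
def pickFin (P : Params) (hN : 1 ≤ P.N) (u : unitInterval) : Fin P.N :=
  ⟨pickIndex P u, pickIndex_lt P hN u⟩

theorem measurable_pickFin (P : Params) (hN : 1 ≤ P.N) : Measurable (pickFin P hN) :=
  measurable_to_countable' fun n => by
    have : pickFin P hN ⁻¹' {n} = (fun u : unitInterval => pickIndex P u) ⁻¹' {(n : ℕ)} := by
      ext u
      simp [pickFin, Fin.ext_iff]
    rw [this]
    exact measurable_pickIndex P (measurableSet_singleton _)

/-- The event is a disjoint union of boxes, one for each good tuple of indices, and the measure of a
box is a product. -/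
theorem sum_prod_le_drawsMeasure {P : Params} (hN : 1 ≤ P.N) (hw : ∀ n < P.N, 0 ≤ P.w n)
    (hW : 0 < P.W) (hsum : P.W = ∑ n ∈ range P.N, P.w n) {ι : Type*} [Fintype ι]
    [DecidableEq ι] (good : (ι → Fin P.N) → Prop) [DecidablePred good] :
    ∑ f with good f, ∏ i, P.w (f i) / P.W ≤
      (drawsMeasure ι).real {v | good fun i => pickFin P hN (v i)} := by
  have hbox : ∀ f : ι → Fin P.N, MeasurableSet
      (Set.pi (Finset.univ : Finset ι) fun i => pickFin P hN ⁻¹' {f i}) := fun f =>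
    MeasurableSet.pi (Finset.countable_toSet _) fun i _ =>
      measurable_pickFin P hN (measurableSet_singleton _)
  have hun : {v : ι → unitInterval | good fun i => pickFin P hN (v i)} =
      ⋃ f ∈ Finset.univ.filter good,
        Set.pi (Finset.univ : Finset ι) fun i => pickFin P hN ⁻¹' {f i} := by
    ext v
    simp only [Set.mem_ofPred_eq, Set.mem_iUnion, Finset.mem_filter, Finset.mem_univ, true_and,
      Set.mem_pi, Finset.coe_univ, Set.mem_univ, forall_true_left, Set.mem_preimage,
      Set.mem_singleton_iff]
    refine ⟨fun h => ⟨_, h, fun _ => rfl⟩, ?_⟩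
    rintro ⟨f, hf, h⟩
    rwa [show (fun i => pickFin P hN (v i)) = f from funext h]
  rw [hun, measureReal_biUnion_finset]
  · refine Finset.sum_le_sum fun f _ => ?_
    rw [measureReal_def, drawsMeasure, Measure.infinitePi_pi _ fun i _ =>
      measurable_pickFin P hN (measurableSet_singleton _), ENNReal.toReal_prod]
    refine Finset.prod_le_prod (fun i _ => div_nonneg (hw _ (f i).2) hW.le) fun i _ => ?_
    refine (le_volume_pickIndex_eq hw hW hsum (f i).2).trans (le_of_eq ?_)
    rw [measureReal_def]
    congr 2
    ext u
    simp [pickFin, Fin.ext_iff]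
  · intro f _ g _ hfg
    rw [Function.onFun, Set.disjoint_left]
    intro v hf hg
    refine hfg (funext fun i => ?_)
    have h1 := hf i (by simp)
    have h2 := hg i (by simp)
    simp only [Set.mem_preimage, Set.mem_singleton_iff] at h1 h2
    exact h1.symm.trans h2
  · exact fun f _ => hbox f

/-- The position on the tape of sample `j` for cluster `k` in trial `t`. -/
def tapePosition {T K s : ℕ} (p : Fin T × Fin K × Fin s) : ℕ :=
  p.1 * (K * s) + (p.2.1 * s + p.2.2)

theorem tapePosition_injective {T K s : ℕ} :
    Function.Injective (tapePosition (T := T) (K := K) (s := s)) := by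
  rintro ⟨t, k, j⟩ ⟨t', k', j'⟩ h
  have hlt : ∀ (k : Fin K) (j : Fin s), (k : ℕ) * s + j < K * s := fun k j => by
    nlinarith [Nat.mul_le_mul_right s k.2, j.2]
  obtain ⟨h1, h2⟩ := (mul_add_inj (hlt k j) (hlt k' j')).1 h
  obtain ⟨h3, h4⟩ := (mul_add_inj j.2 j'.2).1 h2
  have h1 : (t : ℕ) = t' := h1
  simp [Fin.ext_iff, h1, h3, h4]

end RealRAM

namespace RealRAM

open Finset (range)

/-! The running time. -/

/-- All sizes are at least `1`, so each monomial is at most the full product. The coefficients add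
up to less than `8192 = 2 ^ 13`. -/
theorem totalSteps_le {P : Params} (hN : 1 ≤ P.N) (hD : 1 ≤ P.D) (hK : 1 ≤ P.K) (hs : 1 ≤ P.s)
    (hT : 1 ≤ P.T) : totalSteps P ≤ 8192 * (P.N * P.D * P.K * P.s * P.T) := by
  obtain ⟨N, D, K, m, s, T, w, x, W⟩ := P
  simp only at hN hD hK hs hT
  have h : ∀ n d k j t : ℕ, n ≤ N → d ≤ D → k ≤ K → j ≤ s → t ≤ T →
      n * d * k * j * t ≤ N * D * K * s * T := fun n d k j t h1 h2 h3 h4 h5 => by gcongr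
  have h1 := h 1 1 1 s 1 hN hD hK le_rfl hT
  have h2 := h 1 1 1 1 T hN hD hK hs le_rfl
  have h3 := h N 1 1 1 1 le_rfl hD hK hs hT
  have h4 := h N 1 K 1 1 le_rfl hD le_rfl hs hT
  have h5 := h N D K 1 1 le_rfl le_rfl le_rfl hs hT
  have h6 := h 1 1 1 1 1 hN hD hK hs hT
  have h7 := h N 1 K s T le_rfl hD le_rfl le_rfl le_rfl
  have h8 := h 1 1 K s T hN hD le_rfl le_rfl le_rfl
  have h9 := h 1 D K s T hN le_rfl le_rfl le_rfl le_rfl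
  have h10 := h 1 D K 1 T hN le_rfl le_rfl hs le_rfl
  have h11 := h 1 1 K 1 T hN hD le_rfl hs le_rfl
  have h12 := h N D K 1 T le_rfl le_rfl le_rfl hs le_rfl
  have h13 := h N 1 K 1 T le_rfl hD le_rfl hs le_rfl
  have h14 := h N 1 1 1 T le_rfl hD hK hs le_rfl
  simp only [totalSteps, trialSteps]
  ring_nf at h1 h2 h3 h4 h5 h6 h7 h8 h9 h10 h11 h12 h13 h14 ⊢
  linarith

theorem ceil_two_div_le {y : ℝ} (hy : 0 < y) (hy1 : y ≤ 1) : (⌈2 / y⌉₊ : ℝ) ≤ 3 * (1 / y) := by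
  have h1 := (Nat.ceil_lt_add_one (show 0 ≤ 2 / y by positivity)).le
  have h2 : 1 ≤ 1 / y := by rwa [le_div_iff₀ hy, one_mul]
  have h3 : 2 / y = 2 * (1 / y) := by ring
  linarith

theorem one_le_ceil_two_div {y : ℝ} (hy : 0 < y) : 1 ≤ ⌈2 / y⌉₊ :=
  Nat.one_le_ceil_iff.2 (by positivity)

theorem add_one_le_two_rpow {E : ℝ} (hE : 1 ≤ E) : E + 1 ≤ (2 : ℝ) ^ E := by
  have := one_add_mul_self_le_rpow_one_add (s := 1) (by norm_num) hE
  norm_num at this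
  linarith

theorem steps_factor_le {K : ℕ} (hK : 1 ≤ K) {ε α : ℝ} (hε : 0 < ε) (hε1 : ε ≤ 1) (hα : 0 < α)
    (hα1 : α ≤ 1) :
    8192 * ((K : ℝ) * ⌈2 / ε⌉₊ * ⌈2 / α ^ (K * ⌈2 / ε⌉₊)⌉₊) ≤
      (2 : ℝ) ^ (22 * ((K : ℝ) ^ 2 * (1 / ε) * max 1 (Real.logb 2 (1 / (α * ε))))) := by
  set s := ⌈2 / ε⌉₊ with hs
  set M := max 1 (Real.logb 2 (1 / (α * ε))) with hM
  set E := (K : ℝ) ^ 2 * (1 / ε) * M with hE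
  have hK1 : (1 : ℝ) ≤ K := by exact_mod_cast hK
  have hKK : (K : ℝ) ≤ (K : ℝ) ^ 2 := by nlinarith
  have hi : 1 ≤ 1 / ε := by rwa [le_div_iff₀ hε, one_mul]
  have hM1 : 1 ≤ M := le_max_left _ _
  have hKE : (K : ℝ) ≤ E := by
    calc (K : ℝ) = K * 1 * 1 := by ring
      _ ≤ E := by rw [hE]; gcongr
  have hE1 : 1 ≤ E := hK1.trans hKE
  have hs3 : (s : ℝ) ≤ 3 * (1 / ε) := ceil_two_div_le hε hε1
  have hiE : 1 / ε ≤ E := by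
    calc 1 / ε = 1 * (1 / ε) * 1 := by ring
      _ ≤ E := by rw [hE]; gcongr; nlinarith
  have hlog : Real.logb 2 (1 / α) ≤ M := by
    refine le_trans ?_ (le_max_right _ _)
    refine Real.logb_le_logb_of_le (by norm_num) (by positivity) ?_
    exact one_div_le_one_div_of_le (by positivity) (by nlinarith)
  have hlog0 : 0 ≤ Real.logb 2 (1 / α) :=
    Real.logb_nonneg (by norm_num) (by rwa [le_div_iff₀ hα, one_mul])
  have hinv : 1 / α ^ (K * s) ≤ (2 : ℝ) ^ (3 * E) := by
    have h1 : 1 / α ^ (K * s) = (2 : ℝ) ^ (Real.logb 2 (1 / α) * (K * s : ℕ)) := by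
      rw [Real.rpow_mul (by norm_num), Real.rpow_logb (by norm_num) (by norm_num) (by positivity),
        Real.rpow_natCast, one_div_pow]
    rw [h1]
    refine Real.rpow_le_rpow_of_exponent_le (by norm_num) ?_
    push_cast
    -- Here `K ≤ K ^ 2`, `s ≤ 3 / ε`, and `1 / α ≤ 1 / (α * ε)` because `ε ≤ 1`.
    calc Real.logb 2 (1 / α) * (K * s) ≤ M * (K ^ 2 * (3 * (1 / ε))) := by gcongr
      _ = 3 * E := by rw [hE]; ring
  have hT : (⌈2 / α ^ (K * s)⌉₊ : ℝ) ≤ 3 * (2 : ℝ) ^ (3 * E) :=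
    (ceil_two_div_le (by positivity) (pow_le_one₀ hα.le hα1)).trans (by gcongr)
  have h2E := add_one_le_two_rpow hE1
  have h2 : (2 : ℝ) ≤ 2 ^ E := by linarith
  have h13 : (8192 : ℝ) ≤ (2 ^ E) ^ 13 := by
    calc (8192 : ℝ) = 2 ^ 13 := by norm_num
      _ ≤ (2 ^ E) ^ 13 := by gcongr
  have h3 : (3 : ℝ) ≤ (2 ^ E) ^ 2 := by nlinarith
  rw [mul_comm 3 E, Real.rpow_mul (by norm_num)] at hT
  rw [mul_comm 22 E, Real.rpow_mul (by norm_num)]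
  generalize (2 : ℝ) ^ E = y at *
  norm_cast at hT ⊢
  push_cast at hT ⊢
  -- With `y = 2 ^ E ≥ 2`, the constant, `K`, `s` and `T` cost `13`, `1`, `3` and `5` factors `y`,
  -- whence the exponent `22`.
  calc 8192 * ((K : ℝ) * s * ⌈2 / α ^ (K * s)⌉₊)
      ≤ y ^ 13 * (y * (y ^ 2 * y) * (y ^ 2 * y ^ 3)) := by
        gcongr
        · linarith
        · exact hs3.trans (mul_le_mul h3 (by linarith) (by positivity) (by positivity))
        · exact hT.trans (by gcongr)
    _ = y ^ 22 := by ring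

/-! The meaning of the memory. -/

section Memory

variable {N D K m : ℕ} {x : Fin N → EuclideanSpace ℝ (Fin D)} {w : Fin N → ℝ} {P : Params}

/-- The parameters hold the points `x` with the weights `w`. -/
structure Represents (P : Params) (K m : ℕ) (x : Fin N → EuclideanSpace ℝ (Fin D))
    (w : Fin N → ℝ) : Prop where
  hN : P.N = N
  hD : P.D = D
  hK : P.K = K
  hm : P.m = m
  hw : ∀ n : Fin N, P.w n = w n
  hx : ∀ (n : Fin N) (d : Fin D), P.x (n * D + d) = x n d

/-- The means that are stored in an array. -/
def meansOf (D K : ℕ) (M : ℕ → ℝ) (k : Fin K) : EuclideanSpace ℝ (Fin D) :=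
  WithLp.toLp 2 fun d : Fin D => M (k * D + d)

theorem Represents.norm_sub_sq (h : Represents P K m x w) (M : ℕ → ℝ) (n : Fin N) (k : Fin K) :
    ‖x n - meansOf D K M k‖ ^ 2 = sqDist P M n k := by
  rw [EuclideanSpace.real_norm_sq_eq, sqDist, h.hD, Finset.sum_range]
  exact Finset.sum_congr rfl fun d _ => by rw [h.hx]; rfl

theorem Represents.optCost_eq (h : Represents P K m x w) (M : ℕ → ℝ) :
    optCost P M = ∑ n : Fin N, w n * ∑ k ∈ range K,
      FuzzyKMeans.optMembership m K (sqDist P M n) k ^ m * sqDist P M n k := by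
  rw [optCost, h.hN, Finset.sum_range]
  refine Finset.sum_congr rfl fun n _ => ?_
  rw [h.hK, h.hm, h.hw, Finset.mul_sum]
  exact Finset.sum_congr rfl fun k _ => by ring

theorem Represents.cost_eq (h : Represents P K m x w) (M : ℕ → ℝ) {r : Fin N → Fin K → ℝ}
    {q : ℕ → ℕ → ℝ} (hq : ∀ n k, r n k = q n k) :
    FuzzyKMeans.cost m x w (meansOf D K M) r =
      ∑ n : Fin N, w n * ∑ k ∈ range K, q n k ^ m * sqDist P M n k := by
  refine Finset.sum_congr rfl fun n _ => ?_
  rw [Finset.sum_range, Finset.mul_sum]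
  refine Finset.sum_congr rfl fun k _ => ?_
  rw [h.norm_sub_sq, hq]
  ring

theorem Represents.optCost_le (h : Represents P K m x w) (hK : 1 ≤ K) (hm : 1 ≤ m)
    (hw : ∀ n, 0 ≤ w n) (M : ℕ → ℝ) {r : Fin N → Fin K → ℝ} (hr : FuzzyKMeans.IsMembership r) :
    optCost P M ≤ FuzzyKMeans.cost m x w (meansOf D K M) r := by
  rw [h.optCost_eq, h.cost_eq M (q := fun n k => if h : n < N ∧ k < K then r ⟨n, h.1⟩ ⟨k, h.2⟩
    else 0) fun n k => by simp]
  refine Finset.sum_le_sum fun n _ => mul_le_mul_of_nonneg_left ?_ (hw n)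
  refine FuzzyKMeans.sum_optMembership_pow_le hm hK
    (fun k _ => Finset.sum_nonneg fun d _ => sq_nonneg _) (fun k hk => ?_) ?_
  · simp only [n.2, hk, and_self, dif_pos]
    exact (hr.1 n _).1
  · rw [Finset.sum_range, ← hr.2 n]
    exact Finset.sum_congr rfl fun k _ => by simp

/-- The bridge from memory to probability: the means that a trial computes are sample means of a
block of the tape. -/
theorem Represents.meansOf_trialMeans (h : Represents P K m x w) (hN : 1 ≤ P.N) (ω : Tape)
    {T : ℕ} (t : Fin T) :
    meansOf D K (trialMeans P ω t) = FuzzyKMeans.sampleMean x fun i : Fin K × Fin P.s =>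
      Fin.cast h.hN (pickFin P hN (ω (tapePosition (t, i)))) := by
  funext k
  ext d
  have hD : 0 < D := by have := d.2; omega
  simp only [meansOf, trialMeans, FuzzyKMeans.sampleMean, h.hD, h.hK, Nat.mul_comm (k : ℕ) D,
    Nat.mul_add_div hD, Nat.div_eq_of_lt d.2, Nat.mul_add_mod, Nat.mod_eq_of_lt d.2, add_zero,
    PiLp.smul_apply, smul_eq_mul, Finset.sum_range]
  rw [div_eq_inv_mul, WithLp.ofLp_sum, Finset.sum_apply]
  congr 1
  refine Finset.sum_congr rfl fun j _ => ?_
  rw [← h.hx]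
  rfl

end Memory

/-! ### Correctness and success probability of the algorithm -/

theorem represents_inputParams {N D : ℕ} (x : Fin N → EuclideanSpace ℝ (Fin D)) (w : Fin N → ℝ)
    (K m : ℕ) (ε α : ℝ) :
    Represents (inputParams N D K m ((initState x w K m ε α).reals 1)
      ((initState x w K m ε α).reals 2) ε α) K m x w where
  hN := rfl
  hD := rfl
  hK := rfl
  hm := rfl
  hw n := by simp [inputParams, initState]
  hx n d := by
    have hD : 0 < D := by have := d.2; omega
    have hlt : (n : ℕ) * D + d < N * D := by nlinarith [Nat.mul_le_mul_right D n.2, d.2]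
    simp only [inputParams, initState, hlt]
    simp [Nat.mul_comm (n : ℕ) D, Nat.mul_add_div hD, Nat.mod_eq_of_lt d.2,
      Nat.div_eq_of_lt d.2]

/-- The algorithm halts with optimal memberships for means that are at least as good as those of
every trial. -/
theorem exec_fuzzyKMeans {N D K m : ℕ} (hK : 1 ≤ K) (hm : 1 ≤ m)
    (x : Fin N → EuclideanSpace ℝ (Fin D)) {w : Fin N → ℝ} (hw : ∀ n, 0 ≤ w n) {ε α : ℝ}
    (hε : 0 < ε) (hα : 0 < α) (ω : Tape) {P : Params}
    (hP : P = inputParams N D K m ((initState x w K m ε α).reals 1)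
      ((initState x w K m ε α).reals 2) ε α) :
    ∃ τ t, Exec ω fuzzyKMeans (initState x w K m ε α) τ t ∧ t ≤ totalSteps P ∧
      FuzzyKMeans.IsMembership (outMemberships N K τ) ∧
      ∀ t < P.T, ∀ r : Fin N → Fin K → ℝ, FuzzyKMeans.IsMembership r →
        FuzzyKMeans.cost m x w (outMeans D K τ) (outMemberships N K τ) ≤
          FuzzyKMeans.cost m x w (meansOf D K (trialMeans P ω t)) r := by
  obtain ⟨τ, t, he, ht, hq, hbest⟩ := runs_fuzzyKMeans ω (σ := initState x w K m ε α) hε hα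
    (by simp [initState]) (by simp [initState]) (by simp [initState]) (by simp [initState])
    (by simp [initState]) (by simp [initState]) rfl rfl rfl hP
  have hR : Represents P K m x w := hP ▸ represents_inputParams x w K m ε α
  have hout : ∀ n k, outMemberships N K τ n k =
      FuzzyKMeans.optMembership m K (sqDist P (τ.reals 3) n) k := fun n k => hq n n.2 k k.2
  refine ⟨τ, t, he, ht, ⟨fun n k => ?_, fun n => ?_⟩, fun t ht r hr => ?_⟩
  · rw [hout]
    exact ⟨FuzzyKMeans.optMembership_nonneg _ _ _ _, FuzzyKMeans.optMembership_le_one _ _ k.2⟩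
  · rw [← FuzzyKMeans.sum_optMembership m (sqDist P (τ.reals 3) n) hK, Finset.sum_range]
    exact Finset.sum_congr rfl fun k _ => hout n k
  · have h1 : FuzzyKMeans.cost m x w (outMeans D K τ) (outMemberships N K τ) =
        optCost P (τ.reals 3) := by
      rw [hR.optCost_eq]
      -- `outMeans D K τ` unfolds to `meansOf D K (τ.reals 3)`.
      exact hR.cost_eq (τ.reals 3)
        (q := fun n => FuzzyKMeans.optMembership m K (sqDist P (τ.reals 3) n)) hout
    rw [h1]
    exact (hbest t ht).trans (hR.optCost_le hK hm hw _ hr)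

/-- Some trial has a good sample with probability at least `1 / 2`. -/
theorem half_le_tapeMeasure_isGoodSample {N D L K m : ℕ} (hN : 1 ≤ N) (hm : 1 ≤ m)
    {x : Fin N → EuclideanSpace ℝ (Fin D)} {w : Fin N → ℝ} (hw : ∀ n, 0 ≤ w n)
    (hW : 0 < ∑ n, w n) {ε α : ℝ} (hε : 0 < ε) (hα : 0 < α) (hα1 : α ≤ 1)
    {μ : Fin L → EuclideanSpace ℝ (Fin D)} {r : Fin N → Fin L → ℝ}
    (hr : FuzzyKMeans.IsMembership r)
    (hb : FuzzyKMeans.IsBalanced m w (α * ∑ n, w n) K r) {P : Params}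
    (hP : P = inputParams N D K m ((initState x w K m ε α).reals 1)
      ((initState x w K m ε α).reals 2) ε α) :
    1 / 2 ≤ tapeMeasure.real {ω | ∃ t < P.T, ∃ r' : Fin N → Fin K → ℝ,
      FuzzyKMeans.IsMembership r' ∧
      FuzzyKMeans.cost m x w (meansOf D K (trialMeans P ω t)) r' ≤
        (1 + ε) * FuzzyKMeans.cost m x w μ r} := by
  classical
  have hR : Represents P K m x w := hP ▸ represents_inputParams x w K m ε α
  -- Identifying `N` with `P.N` lets the values of `pickFin` index the points directly.
  obtain rfl : N = P.N := hR.hN.symm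
  have hs : 2 ≤ (P.s : ℝ) * ε := by
    rw [hP]
    exact (div_le_iff₀ hε).1 (Nat.le_ceil _)
  have hT : 2 ≤ (P.T : ℝ) * α ^ (K * P.s) := by
    rw [hP]
    exact (div_le_iff₀ (pow_pos hα _)).1 (Nat.le_ceil _)
  have hPW : P.W = ∑ n ∈ range P.N, P.w n := by
    rw [hP]; rfl
  have hPW' : P.W = ∑ n, w n := by
    rw [hPW, Finset.sum_range]
    exact Finset.sum_congr rfl fun n _ => hR.hw n
  have hPw : ∀ n < P.N, 0 ≤ P.w n := fun n hn => by
    have := hw ⟨n, hn⟩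
    rwa [← hR.hw] at this
  set good : (Fin K × Fin P.s → Fin P.N) → Prop :=
    FuzzyKMeans.IsGoodSample m x w ε μ r with hgood
  have h1 := FuzzyKMeans.le_sum_prod_isGoodSample hm hw hW hα hα1 hε hs (x := x) (μ := μ) hr hb
  have h2 := sum_prod_le_drawsMeasure hN hPw (hPW' ▸ hW) hPW good
  have h3 : α ^ (K * P.s) / 2 ≤
      (drawsMeasure (Fin K × Fin P.s)).real {v | good fun i => pickFin P hN (v i)} := by
    refine le_trans h1 (le_trans (le_of_eq ?_) h2)
    rw [hPW']
    exact Finset.sum_congr rfl fun f _ => Finset.prod_congr rfl fun i _ => by rw [hR.hw]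
  have hmeas : MeasurableSet
      {v : Fin K × Fin P.s → unitInterval | good fun i => pickFin P hN (v i)} := by
    have h4 : Measurable fun (v : Fin K × Fin P.s → unitInterval) i => pickFin P hN (v i) :=
      measurable_pi_lambda _ fun i => (measurable_pickFin P hN).comp (measurable_pi_apply i)
    exact h4 (Set.toFinite {f | good f}).measurableSet
  -- The `2` in `T = ⌈2 / α ^ (K * s)⌉₊` compensates the half lost to Markov's inequality, so `1 ≤ T
  -- * (α ^ (K * s) / 2)`.
  refine (half_le_tapeMeasure_exists_block (T := P.T) tapePosition_injective hmeas h3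
    (by linarith)).trans (measureReal_mono ?_)
  rintro ω ⟨t, r', hr', hc⟩
  refine ⟨t, t.2, r', hr', ?_⟩
  rw [hR.meansOf_trialMeans hN]
  exact hc

end RealRAM

end

theorem theorem4 :
    ∃ (prog : RealRAM.Cmd) (c p : ℝ), 0 < c ∧ 0 < p ∧
      ∀ (N D K m : ℕ), 1 ≤ N → 1 ≤ D → 1 ≤ K → 1 ≤ m →
      ∀ (x : Fin N → EuclideanSpace ℝ (Fin D)) (w : Fin N → ℚ≥0) (ε α : ℝ),
        0 < ε → ε ≤ 1 → 0 < α → α ≤ 1 →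
        -- an optimal balanced solution exists
        (∃ (L : ℕ) (μ : Fin L → EuclideanSpace ℝ (Fin D)) (r : Fin N → Fin L → ℝ),
          FuzzyKMeans.IsOptimalBalanced m x (fun n => (w n : ℝ)) (α * ∑ n, (w n : ℝ)) K μ r) ∧
        -- for all random choices: the running time, and the output is a solution
        (∀ ω : RealRAM.Tape, ∃ (τ : RealRAM.State) (t : ℕ),
          RealRAM.Exec ω prog (RealRAM.initState x (fun n => (w n : ℝ)) K m ε α) τ t ∧
          (t : ℝ) ≤ (N : ℝ) * (D : ℝ) *
            (2 : ℝ) ^ (c * ((K : ℝ) ^ 2 * (1 / ε) * max 1 (Real.logb 2 (1 / (α * ε))))) ∧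
          FuzzyKMeans.IsMembership (RealRAM.outMemberships N K τ)) ∧
        -- with constant probability: the cost of the output
        (∀ (L : ℕ) (μ : Fin L → EuclideanSpace ℝ (Fin D)) (r : Fin N → Fin L → ℝ),
          FuzzyKMeans.IsOptimalBalanced m x (fun n => (w n : ℝ)) (α * ∑ n, (w n : ℝ)) K μ r →
          p ≤ RealRAM.tapeMeasure.real {ω : RealRAM.Tape | ∃ (τ : RealRAM.State) (t : ℕ),
            RealRAM.Exec ω prog (RealRAM.initState x (fun n => (w n : ℝ)) K m ε α) τ t ∧
            FuzzyKMeans.cost m x (fun n => (w n : ℝ))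
                (RealRAM.outMeans D K τ) (RealRAM.outMemberships N K τ) ≤
              (1 + ε) * FuzzyKMeans.cost m x (fun n => (w n : ℝ)) μ r}) := by
  refine ⟨RealRAM.fuzzyKMeans, 22, 1 / 2, by norm_num, by norm_num, ?_⟩
  intro N D K m hN hD hK hm x w ε α hε hε1 hα hα1
  have hw : ∀ n, (0 : ℝ) ≤ (w n : ℝ) := fun n => by positivity
  set v : Fin N → ℝ := fun n => (w n : ℝ) with hv
  obtain ⟨P, hP⟩ : ∃ P, P = RealRAM.inputParams N D K m
    ((RealRAM.initState x v K m ε α).reals 1) ((RealRAM.initState x v K m ε α).reals 2) ε α :=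
    ⟨_, rfl⟩
  have hexec := fun ω => RealRAM.exec_fuzzyKMeans hK hm x hw hε hα ω hP
  refine ⟨FuzzyKMeans.exists_isOptimalBalanced hK m x hw hα hα1, fun ω => ?_, ?_⟩
  · obtain ⟨τ, t, he, ht, hmem, -⟩ := hexec ω
    refine ⟨τ, t, he, ?_, hmem⟩
    have hNDKsT := RealRAM.totalSteps_le (P := P) (hP ▸ hN) (hP ▸ hD) (hP ▸ hK)
      (hP ▸ RealRAM.one_le_ceil_two_div hε) (hP ▸ RealRAM.one_le_ceil_two_div (pow_pos hα _))
    have h1 : (t : ℝ) ≤ (8192 * (P.N * P.D * P.K * P.s * P.T) : ℕ) :=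
      Nat.cast_le.2 (ht.trans hNDKsT)
    rw [hP] at h1
    simp only [RealRAM.inputParams] at h1
    push_cast at h1
    refine h1.trans (le_trans (le_of_eq ?_) (mul_le_mul_of_nonneg_left
      (RealRAM.steps_factor_le hK hε hε1 hα hα1) (by positivity : (0 : ℝ) ≤ N * D)))
    ring
  · intro L μ r hopt
    obtain ⟨hr, hb, -⟩ := hopt
    have hWnn : 0 ≤ ∑ n, v n := Finset.sum_nonneg fun n _ => hw n
    -- With total weight zero there is no sampling distribution, but every solution costs `0`.
    rcases hWnn.eq_or_lt with hW | hW
    · have hz : ∀ n, v n = 0 :=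
        fun n => (Finset.sum_eq_zero_iff_of_nonneg fun n _ => hw n).1 hW.symm n
          (Finset.mem_univ n)
      have huniv : {ω : RealRAM.Tape | ∃ (τ : RealRAM.State) (t : ℕ),
          RealRAM.Exec ω RealRAM.fuzzyKMeans (RealRAM.initState x v K m ε α) τ t ∧
          FuzzyKMeans.cost m x v (RealRAM.outMeans D K τ) (RealRAM.outMemberships N K τ) ≤
            (1 + ε) * FuzzyKMeans.cost m x v μ r} = Set.univ := by
        refine Set.eq_univ_of_forall fun ω => ?_
        obtain ⟨τ, t, he, -⟩ := hexec ω
        exact ⟨τ, t, he, by simp [FuzzyKMeans.cost, hz]⟩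
      rw [huniv, probReal_univ]
      norm_num
    · refine (RealRAM.half_le_tapeMeasure_isGoodSample hN hm hw hW hε hα hα1 (μ := μ) hr hb
        hP).trans (measureReal_mono ?_)
      rintro ω ⟨t, ht, r', hr', hc⟩
      obtain ⟨τ, t', he, -, -, hbest⟩ := hexec ω
      exact ⟨τ, t', he, (hbest t ht r' hr').trans hc⟩
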